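/- Let $X=[0,\infty)$ with its Borel $\sigma$-algebra and Lebesgue measure $\mu$, and let $\mathcal M$ be the group of invertible measure-preserving transformations of $X$ (two transformations are identified if they agree almost everywhere), with the weak topology: the topology generated by the sets $\{S\in\mathcal M:\mu(TA\,\triangle\,SA)+\mu(T^{-1}A\,\triangle\,S^{-1}A)<\varepsilon\}$, where $T\in\mathcal M$, $\varepsilon>0$ and $A\subset X$ is a Borel set of finite measure; thus $T_n\to T$ if and only if $\mu(T_nA\,\triangle\,TA)+\mu(T_n^{-1}A\,\triangle\,T^{-1}A)\to0$ for every such $A$. A (Rokhlin) column of $T$ of height $h\ge1$ is a sequence of pairwise disjoint measurable sets (levels) $B,TB,\dots,T^{h-1}B$. It approximates a set $A$ of finite measure with accuracy $\varepsilon>0$ if $\mu(A\,\triangle\,B')<\varepsilon$ for some union $B'$ of levels. The transformation $T$ is rank-one if there is a sequence of columns $C_n$ of $T$ such that for every measurable set $A$ of finite measure and every $\varepsilon>0$ there is an $N$ such that $C_n$ approximates $A$ with accuracy $\varepsilon$ for all $n\ge N$. (These notions do not depend on the choice of representatives.) Theorem. The rank-one transformations are generic in $\mathcal M$ under the weak topology: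 the set of rank-one transformations contains a dense $G_\delta$ subset of $\mathcal M$. Moreover, let $A_1,A_2,\dots$ be any sequence of Borel sets of finite measure that is dense in the collection of Borel sets of finite measure, that is, for every Borel set $D$ with $\mu(D)<\infty$ and every $\varepsilon>0$ there is an $i$ with $\mu(D\,\triangle\,A_i)<\varepsilon$ (for example, an enumeration of the finite unions of dyadic intervals). For $j\ge1$ let $\mathcal R_j$ be the set of those $T\in\mathcal M$ that have a column which approximates each of $A_1,\dots,A_j$ with accuracy $1/j$. Then every $\mathcal R_j$ is open and dense in $\mathcal M$, and $\bigcap_{j\ge1}\mathcal R_j$ is a dense $G_\delta$ set all of whose elements are rank-one. -/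

import Mathlib

open MeasureTheory Set
open scoped NNReal ENNReal symmDiff

/-- Lebesgue measure on `[0, ∞)`: the restriction of Lebesgue measure on `ℝ`. -/
noncomputable def leb : Measure ℝ≥0 :=
  Measure.comap ((↑) : ℝ≥0 → ℝ) volume

/-- The group of (everywhere defined) invertible measure-preserving transformations of `[0, ∞)`:
bijections that, together with their inverse, are Borel measurable and preserve Lebesgue measure.
The group law is composition. -/
def mpSubgroup : Subgroup (Equiv.Perm ℝ≥0) where
  carrier := {T | MeasurePreserving T leb leb ∧ MeasurePreserving T.symm leb leb}
  mul_mem' := by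
    rintro S T ⟨hS, hS'⟩ ⟨hT, hT'⟩
    exact ⟨hS.comp hT, hT'.comp hS'⟩
  one_mem' := ⟨MeasurePreserving.id _, MeasurePreserving.id _⟩
  inv_mem' := by
    rintro S ⟨hS, hS'⟩
    exact ⟨hS', hS⟩

/-- The group of invertible measure-preserving transformations of `[0, ∞)`. -/
abbrev MPAut : Type := mpSubgroup

namespace MPAut

/-- The transformation underlying an element of `MPAut`, as a function. -/
def toFun (T : MPAut) : ℝ≥0 → ℝ≥0 := (T : Equiv.Perm ℝ≥0)

theorem measurePreserving (T : MPAut) : MeasurePreserving T.toFun leb leb := T.2.1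

theorem toFun_one : toFun 1 = id := rfl

theorem toFun_mul (S T : MPAut) : (S * T).toFun = S.toFun ∘ T.toFun := rfl

theorem toFun_inv_comp (T : MPAut) : T⁻¹.toFun ∘ T.toFun = id := by
  rw [← toFun_mul, inv_mul_cancel, toFun_one]

theorem toFun_comp_inv (T : MPAut) : T.toFun ∘ T⁻¹.toFun = id := by
  rw [← toFun_mul, mul_inv_cancel, toFun_one]

theorem image_eq (T : MPAut) (A : Set ℝ≥0) : T.toFun '' A = T⁻¹.toFun ⁻¹' A :=
  congrFun (image_eq_preimage_of_inverse (f := T.toFun) (g := T⁻¹.toFun)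
    (fun x => congrFun T.toFun_inv_comp x) (fun x => congrFun T.toFun_comp_inv x)) A

theorem toFun_pow (T : MPAut) (i : ℕ) : (T ^ i).toFun = T.toFun^[i] := by
  induction i with
  | zero => rfl
  | succ n ih => rw [pow_succ, toFun_mul, ih, Function.iterate_succ]

end MPAut

/-- The transformations that are equal to the identity almost everywhere. -/
def aeId : Subgroup MPAut where
  carrier := {T | T.toFun =ᵐ[leb] id}
  mul_mem' := by
    intro S T hS hT
    have h := T.measurePreserving.quasiMeasurePreserving.ae_eq_comp hS
    exact h.trans hT
  one_mem' := Filter.EventuallyEq.refl (ae leb) id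
  inv_mem' := by
    intro T hT
    have h := T⁻¹.measurePreserving.quasiMeasurePreserving.ae_eq_comp hT
    rw [T.toFun_comp_inv] at h
    exact h.symm

instance aeId_normal : aeId.Normal where
  conj_mem := by
    intro T hT S
    have h := S⁻¹.measurePreserving.quasiMeasurePreserving.ae_eq_comp hT
    have h2 : S.toFun ∘ (T.toFun ∘ S⁻¹.toFun) =ᵐ[leb] S.toFun ∘ (id ∘ S⁻¹.toFun) := h.fun_comp _
    change (S * T * S⁻¹).toFun =ᵐ[leb] id
    rw [MPAut.toFun_mul, MPAut.toFun_mul]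
    rw [Function.id_comp, S.toFun_comp_inv] at h2
    exact h2

/-- The group `𝓜` of invertible measure-preserving transformations of `[0, ∞)`, where two
transformations that agree almost everywhere are identified. -/
abbrev MPGroup : Type := MPAut ⧸ aeId

/-- Two transformations are identified in `𝓜` exactly when they agree almost everywhere. -/
theorem mk_eq_mk_iff (S T : MPAut) :
    (S : MPGroup) = (T : MPGroup) ↔ S.toFun =ᵐ[leb] T.toFun := by
  rw [QuotientGroup.eq]
  change (S⁻¹ * T).toFun =ᵐ[leb] id ↔ _
  rw [MPAut.toFun_mul]
  constructor
  · intro h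
    have h2 : S.toFun ∘ (S⁻¹.toFun ∘ T.toFun) =ᵐ[leb] S.toFun ∘ id := h.fun_comp _
    rw [← Function.comp_assoc, S.toFun_comp_inv] at h2
    exact h2.symm
  · intro h
    have h2 : S⁻¹.toFun ∘ S.toFun =ᵐ[leb] S⁻¹.toFun ∘ T.toFun := h.fun_comp _
    rw [S.toFun_inv_comp] at h2
    exact h2.symm

/-- `μ(TA △ SA) + μ(T⁻¹A △ S⁻¹A)` for transformations `T`, `S` and a set `A`. -/
noncomputable def autDist (A : Set ℝ≥0) (T S : MPAut) : ℝ≥0∞ :=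
  leb ((T.toFun '' A) ∆ (S.toFun '' A)) + leb ((T⁻¹.toFun '' A) ∆ (S⁻¹.toFun '' A))

theorem image_ae_congr {T T' : MPAut} (h : T.toFun =ᵐ[leb] T'.toFun) (A : Set ℝ≥0) :
    (T.toFun '' A : Set ℝ≥0) =ᵐ[leb] (T'.toFun '' A : Set ℝ≥0) := by
  have h1 : (T⁻¹ : MPGroup) = (T'⁻¹ : MPGroup) := by rw [(mk_eq_mk_iff T T').2 h]
  have h2 : T⁻¹.toFun =ᵐ[leb] T'⁻¹.toFun := (mk_eq_mk_iff _ _).1 h1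
  rw [T.image_eq, T'.image_eq]
  filter_upwards [h2] with x hx
  exact congrArg (fun y => y ∈ A) hx

theorem autDist_congr (A : Set ℝ≥0) (T S T' S' : MPAut) (hT : T.toFun =ᵐ[leb] T'.toFun)
    (hS : S.toFun =ᵐ[leb] S'.toFun) : autDist A T S = autDist A T' S' := by
  have inv_congr : ∀ {U U' : MPAut}, U.toFun =ᵐ[leb] U'.toFun →
      U⁻¹.toFun =ᵐ[leb] U'⁻¹.toFun := by
    intro U U' h
    refine (mk_eq_mk_iff _ _).1 ?_
    change (U : MPGroup)⁻¹ = (U' : MPGroup)⁻¹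
    rw [(mk_eq_mk_iff U U').2 h]
  unfold autDist
  rw [measure_congr ((image_ae_congr hT A).symmDiff (image_ae_congr hS A)),
    measure_congr ((image_ae_congr (inv_congr hT) A).symmDiff
      (image_ae_congr (inv_congr hS) A))]

/-- `μ(TA △ SA) + μ(T⁻¹A △ S⁻¹A)` for elements `T`, `S` of `𝓜` and a set `A`. -/
noncomputable def weakDist (A : Set ℝ≥0) : MPGroup → MPGroup → ℝ≥0∞ :=
  Quotient.lift₂ (autDist A) (fun T S T' S' hT hS =>
    autDist_congr A T S T' S'
      ((mk_eq_mk_iff T T').1 (Quotient.sound hT)) ((mk_eq_mk_iff S S').1 (Quotient.sound hS)))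

/-- The weak topology on `𝓜`: the topology generated by the sets
`{S | μ(TA △ SA) + μ(T⁻¹A △ S⁻¹A) < ε}`, with `T ∈ 𝓜`, `A` a Borel set of finite measure and
`ε > 0`. Thus `Tₙ → T` if and only if `μ(TₙA △ TA) + μ(Tₙ⁻¹A △ T⁻¹A) → 0` for all Borel sets `A`
of finite measure. -/
instance weakTopology : TopologicalSpace MPGroup :=
  TopologicalSpace.generateFrom
    {U | ∃ (T : MPGroup) (A : Set ℝ≥0) (ε : ℝ), MeasurableSet A ∧ leb A < ∞ ∧ 0 < ε ∧
      U = {S | weakDist A T S < ENNReal.ofReal ε}}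

/-- `B, T B, …, T^(h-1) B` is a Rokhlin column of height `h` for `T`: the base `B` is measurable
(hence so are all the levels) and the levels are pairwise disjoint. -/
structure IsColumn (T : MPAut) (B : Set ℝ≥0) (h : ℕ) : Prop where
  height_pos : 1 ≤ h
  measurable_base : MeasurableSet B
  disjoint : ∀ i < h, ∀ j < h, i ≠ j → Disjoint (T.toFun^[i] '' B) (T.toFun^[j] '' B)

/-- The column `B, T B, …, T^(h-1) B` approximates the set `A` with accuracy `ε`: some union of
levels `B'` satisfies `μ(A △ B') < ε`. -/
def ColumnApprox (T : MPAut) (B : Set ℝ≥0) (h : ℕ) (A : Set ℝ≥0) (ε : ℝ) : Prop :=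
  ∃ E : Finset ℕ, (∀ i ∈ E, i < h) ∧ leb (A ∆ ⋃ i ∈ E, T.toFun^[i] '' B) < ENNReal.ofReal ε

/-- `T` is rank-one: there is a sequence of Rokhlin columns that approximates every measurable set
of finite measure. -/
def IsRankOneAut (T : MPAut) : Prop :=
  ∃ (B : ℕ → Set ℝ≥0) (h : ℕ → ℕ), (∀ n, IsColumn T (B n) (h n)) ∧
    ∀ A : Set ℝ≥0, MeasurableSet A → leb A < ∞ → ∀ ε : ℝ, 0 < ε →
      ∃ N : ℕ, ∀ n ≥ N, ColumnApprox T (B n) (h n) A ε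

/-- `T` has a Rokhlin column that approximates each of the first `j` sets
`A 0, …, A (j - 1)` of a sequence with accuracy `1 / j`. -/
def HasApproxColumn (A : ℕ → Set ℝ≥0) (j : ℕ) (T : MPAut) : Prop :=
  ∃ (B : Set ℝ≥0) (h : ℕ), IsColumn T B h ∧ ∀ i < j, ColumnApprox T B h (A i) (1 / (j : ℝ))

theorem iterate_ae_congr {S T : MPAut} (hST : S.toFun =ᵐ[leb] T.toFun) (i : ℕ) :
    S.toFun^[i] =ᵐ[leb] T.toFun^[i] := by
  rw [← MPAut.toFun_pow, ← MPAut.toFun_pow]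
  refine (mk_eq_mk_iff _ _).1 ?_
  change (S : MPGroup) ^ i = (T : MPGroup) ^ i
  rw [(mk_eq_mk_iff S T).2 hST]

/-- Columns do not depend on the representative: removing a null set from the base of a column of
`S` gives a column of any `T` that agrees with `S` almost everywhere, with the same levels up to
null sets. -/
theorem exists_column_congr {S T : MPAut} (hST : S.toFun =ᵐ[leb] T.toFun) {B : Set ℝ≥0} {h : ℕ}
    (hB : IsColumn S B h) :
    ∃ B' : Set ℝ≥0, IsColumn T B' h ∧
      ∀ A ε, ColumnApprox S B h A ε → ColumnApprox T B' h A ε := by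
  have hall : ∀ᵐ x ∂leb, ∀ i : ℕ, S.toFun^[i] x = T.toFun^[i] x :=
    ae_all_iff.2 (iterate_ae_congr hST)
  obtain ⟨N, hNsub, hNm, hN0⟩ := exists_measurable_superset_of_null (ae_iff.1 hall)
  have heq : ∀ x, x ∉ N → ∀ i : ℕ, S.toFun^[i] x = T.toFun^[i] x := by
    intro x hx
    by_contra hcon
    exact hx (hNsub hcon)
  have himg : ∀ i : ℕ, T.toFun^[i] '' (B \ N) = S.toFun^[i] '' (B \ N) := fun i =>
    image_congr fun x hx => (heq x hx.2 i).symm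
  have hae : ∀ i : ℕ, (S.toFun^[i] '' B : Set ℝ≥0) =ᵐ[leb] (T.toFun^[i] '' (B \ N) : Set ℝ≥0) := by
    intro i
    rw [himg, ← MPAut.toFun_pow, MPAut.image_eq, MPAut.image_eq, preimage_sdiff]
    refine (sdiff_null_ae_eq_self ?_).symm
    exact ((S ^ i)⁻¹.measurePreserving.quasiMeasurePreserving.preimage_null hN0)
  refine ⟨B \ N, ⟨hB.height_pos, hB.measurable_base.diff hNm, ?_⟩, ?_⟩
  · intro i hi j hj hij
    rw [himg, himg]
    exact (hB.disjoint i hi j hj hij).mono (image_mono sdiff_subset) (image_mono sdiff_subset)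
  · rintro A ε ⟨E, hE, hlt⟩
    refine ⟨E, hE, ?_⟩
    have hU : (⋃ i ∈ E, S.toFun^[i] '' B : Set ℝ≥0) =ᵐ[leb]
        (⋃ i ∈ E, T.toFun^[i] '' (B \ N) : Set ℝ≥0) :=
      Filter.EventuallyEq.countable_bUnion E.countable_toSet fun i _ => hae i
    rwa [measure_congr ((ae_eq_refl A).symmDiff hU)] at hlt

theorem IsRankOneAut.congr {S T : MPAut} (hST : S.toFun =ᵐ[leb] T.toFun) (hS : IsRankOneAut S) :
    IsRankOneAut T := by
  obtain ⟨B, h, hcol, happ⟩ := hS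
  choose B' hB' happ' using fun n => exists_column_congr hST (hcol n)
  refine ⟨B', h, hB', fun A hA hA' ε hε => ?_⟩
  obtain ⟨N, hN⟩ := happ A hA hA' ε hε
  exact ⟨N, fun n hn => happ' n A ε (hN n hn)⟩

theorem HasApproxColumn.congr {A : ℕ → Set ℝ≥0} {j : ℕ} {S T : MPAut}
    (hST : S.toFun =ᵐ[leb] T.toFun) (hS : HasApproxColumn A j S) : HasApproxColumn A j T := by
  obtain ⟨B, h, hcol, happ⟩ := hS
  obtain ⟨B', hB', happ'⟩ := exists_column_congr hST hcol
  exact ⟨B', h, hB', fun i hi => happ' _ _ (happ i hi)⟩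

/-- The property of being rank-one, for elements of `𝓜`. -/
def IsRankOne : MPGroup → Prop :=
  Quotient.lift IsRankOneAut fun S T hST =>
    have h := (mk_eq_mk_iff S T).1 (Quotient.sound hST)
    propext ⟨IsRankOneAut.congr h, IsRankOneAut.congr h.symm⟩

/-- The set `𝓡_j` of those `T ∈ 𝓜` that have a Rokhlin column that approximates the first `j` sets
of the sequence `A` with accuracy `1 / j`. -/
def approxSet (A : ℕ → Set ℝ≥0) (j : ℕ) : Set MPGroup :=
  {T | Quotient.lift (HasApproxColumn A j) (fun S T hST =>
    have h := (mk_eq_mk_iff S T).1 (Quotient.sound hST)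
    propext ⟨HasApproxColumn.congr h, HasApproxColumn.congr h.symm⟩) T}

/-- The intersection `𝓡 = ⋂_{j ≥ 1} 𝓡_j`. -/
def approxInter (A : ℕ → Set ℝ≥0) : Set MPGroup :=
  {T | ∀ j : ℕ, 1 ≤ j → T ∈ approxSet A j}

/-- `A 0, A 1, …` is a dense sequence in the collection of Borel sets of finite measure. -/
structure IsDenseSeq (A : ℕ → Set ℝ≥0) : Prop where
  measurable : ∀ i, MeasurableSet (A i)
  finite : ∀ i, leb (A i) < ∞
  dense : ∀ D : Set ℝ≥0, MeasurableSet D → leb D < ∞ → ∀ ε : ℝ, 0 < ε →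
    ∃ i, leb (D ∆ A i) < ENNReal.ofReal ε

/-! The proof shows that each `approxSet A j` is open and dense and that `MPGroup` is a Baire space.

Openness: a column has finitely many levels. If `S` moves each level of a column of `T` almost as
`T` does, discarding a small part of the base leaves a column of `S` with nearly the same levels
(`exists_column_near`), and the strict inequalities in `ColumnApprox` absorb the error.

Density: replace the relevant sets and their preimages under `T` by unions of cells of length `1 /
N`. The proportions of each cell that `T` sends to the others form a substochastic matrix. Completed
to a doubly stochastic matrix of twice the size, it is by Birkhoff's theorem a convex combination of
permutations, so some permutation of cells imitates `T` on the grid sets as well as the matrix does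
on average (`exists_perm_near`). Cut every cell into `R` subcells, `R` a large prime. The
permutation lifts to the subcells with at most one cycle per cell, and joining these cycles alters a
negligible proportion of the subcells (`exists_single_cycle_blocks`). The resulting cyclic interval
exchange is close to `T`, and the permuted subcells are the levels of one column
(`exists_near_with_column`).

Baire property: the weak topology comes from a complete pseudo-metric. A fast Cauchy sequence
converges pointwise almost everywhere, by Borel–Cantelli on grid cells together with tightness. So
do the inverses, and the two limits, inverse to each other almost everywhere, are corrected on null
sets to a Borel bijection (`exists_limit_of_cauchy`).

Finally, a transformation in all `approxSet A j` is rank-one, because the `A i` approximate every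
set of finite measure. -/

/-! ### Permutations: merging cycles, and rounding matrices by Birkhoff's theorem. -/

section Combinatorics
open Equiv Finset

/-- Multiplying by a transposition of points in different cycles merges their cycles. -/
theorem sameCycle_mul_swap {α : Type*} [Finite α] [DecidableEq α] {τ : Perm α} {c d : α}
    (h : ¬ τ.SameCycle c d) (k : ℕ) : (τ * swap c d).SameCycle c ((τ ^ (k + 1)) d) := by
  have hc : (τ * swap c d).SameCycle c (τ d) := by
    refine ⟨1, ?_⟩
    simp
  induction k with
  | zero => simpa using hc
  | succ k ih =>
    rw [pow_succ', Perm.mul_apply]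
    -- If the orbit has returned to `d`, its next point is `τ d`, which `hc` covers. Otherwise the
    -- transposition does not touch the current point.
    by_cases hx : (τ ^ (k + 1)) d = d
    · rw [hx]; exact hc
    · have hx' : (τ ^ (k + 1)) d ≠ c := fun h' => h (Perm.SameCycle.symm ⟨((k + 1 : ℕ) : ℤ), by rw [zpow_natCast]; exact h'⟩)
      have : (τ * swap c d) ((τ ^ (k + 1)) d) = τ ((τ ^ (k + 1)) d) := by
        rw [Perm.mul_apply, swap_apply_of_ne_of_ne hx' hx]
      rw [← this]
      exact (Perm.sameCycle_apply_right).2 ih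

theorem sameCycle_mul_swap_of_sameCycle {α : Type*} [Finite α] [DecidableEq α] {τ : Perm α}
    {c d w : α} (h : ¬ τ.SameCycle c d) (hw : τ.SameCycle d w) :
    (τ * swap c d).SameCycle c w := by
  -- The exponent can be taken positive: `d` itself is reached after a full turn.
  obtain ⟨i, hi, -, rfl⟩ := hw.exists_pow_eq''
  obtain ⟨k, rfl⟩ := Nat.exists_eq_succ_of_ne_zero hi.ne'
  exact sameCycle_mul_swap h k

/-- The cycle of `e` avoids `c` and `d`, so the transposition fixes all its points. -/
theorem sameCycle_mul_swap_of_not {α : Type*} [Finite α] [DecidableEq α] {τ : Perm α}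
    {c d e w : α} (hc : ¬ τ.SameCycle e c) (hd : ¬ τ.SameCycle e d) (hw : τ.SameCycle e w) :
    (τ * swap c d).SameCycle e w := by
  obtain ⟨i, -, rfl⟩ := hw.exists_pow_eq'
  induction i with
  | zero => exact Perm.SameCycle.refl _ _
  | succ k ih =>
    have hk : τ.SameCycle e ((τ ^ k) e) := ⟨k, by simp⟩
    have ih := ih hk
    have h1 : (τ ^ k) e ≠ c := fun h => hc (h ▸ hk)
    have h2 : (τ ^ k) e ≠ d := fun h => hd (h ▸ hk)
    rw [pow_succ', Perm.mul_apply]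
    have : (τ * swap c d) ((τ ^ k) e) = τ ((τ ^ k) e) := by
      rw [Perm.mul_apply, swap_apply_of_ne_of_ne h1 h2]
    rw [← this]
    exact (Perm.sameCycle_apply_right).2 ih

/-- A permutation all of whose cycles meet a finite set `C` differs from some permutation with a
single cycle in at most `2 * #C` points. -/
theorem exists_single_cycle_near {α : Type*} [Fintype α] [DecidableEq α] (C : Finset α) :
    C.Nonempty → ∀ τ : Perm α, (∀ w, ∃ c ∈ C, τ.SameCycle c w) →
    ∃ ρ : Perm α, (∀ v w, ρ.SameCycle v w) ∧ #{w | ρ w ≠ τ w} ≤ 2 * #C := by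
  intro hC
  induction hC using Finset.Nonempty.cons_induction with
  | singleton a =>
    intro τ h
    simp only [Finset.mem_singleton, exists_eq_left] at h
    exact ⟨τ, fun v w => (h v).symm.trans (h w), by simp⟩
  | cons d C hd hC ih =>
    intro τ h
    by_cases hdC : ∃ c ∈ C, τ.SameCycle c d
    · obtain ⟨c, hc, hcd⟩ := hdC
      obtain ⟨ρ, h1, h2⟩ := ih τ (fun w => by
        obtain ⟨e, he, hew⟩ := h w
        rcases Finset.mem_cons.1 he with rfl | he
        · exact ⟨c, hc, hcd.trans hew⟩
        · exact ⟨e, he, hew⟩)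
      exact ⟨ρ, h1, h2.trans (by rw [Finset.card_cons]; omega)⟩
    -- Here `C` misses the cycle of `d`. A transposition joins this cycle to that of some `c ∈ C`,
    -- so that `C` alone meets all cycles, at the cost of changing two values.
    · push Not at hdC
      obtain ⟨c, hc⟩ := hC
      have hcd := hdC c hc
      have hdc : ¬ τ.SameCycle d c := fun h => hcd h.symm
      obtain ⟨ρ, h1, h2⟩ := ih (τ * swap c d) (fun w => by
        obtain ⟨e, he, hew⟩ := h w
        rcases Finset.mem_cons.1 he with rfl | he
        · exact ⟨c, hc, sameCycle_mul_swap_of_sameCycle hcd hew⟩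
        · by_cases hec : τ.SameCycle e c
          · refine ⟨c, hc, ?_⟩
            have h3 : (τ * swap c d).SameCycle d c := by
              rw [swap_comm]
              exact sameCycle_mul_swap_of_sameCycle hdc (Perm.SameCycle.refl _ _)
            have h4 : (τ * swap c d).SameCycle d w := by
              rw [swap_comm]
              exact sameCycle_mul_swap_of_sameCycle hdc (hec.symm.trans hew)
            exact h3.symm.trans h4
          · exact ⟨e, he, sameCycle_mul_swap_of_not hec (hdC e he) hew⟩)
      refine ⟨ρ, h1, ?_⟩
      have hsub : ({w | ρ w ≠ τ w} : Finset α) ⊆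
          ({w | ρ w ≠ (τ * swap c d) w} : Finset α) ∪ {c, d} := by
        intro w hw
        simp only [Finset.mem_filter, Finset.mem_univ, true_and, Finset.mem_union,
          Finset.mem_insert, Finset.mem_singleton] at hw ⊢
        by_contra hcon
        push Not at hcon
        obtain ⟨h5, h6, h7⟩ := hcon
        rw [Perm.mul_apply, swap_apply_of_ne_of_ne h6 h7] at h5
        exact hw h5
      have h8 : #({c, d} : Finset α) ≤ 2 := Finset.card_le_two
      calc _ ≤ _ := Finset.card_le_card hsub
        _ ≤ _ := Finset.card_union_le _ _
        _ ≤ _ := by rw [Finset.card_cons]; omega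

theorem prodCongr_addRight_pow {L R : ℕ} (π : Perm (Fin L)) (k : ℕ) (u : Fin L) (t : ZMod R) :
    ((prodCongr π (Equiv.addRight (1 : ZMod R)) : Perm (Fin L × ZMod R)) ^ k) (u, t)
      = ((π ^ k) u, t + k) := by
  induction k with
  | zero => simp
  | succ k ih =>
    rw [pow_succ', Perm.mul_apply, ih, pow_succ', Perm.mul_apply]
    simp [add_assoc]

/-- A permutation of `Fin L`, acting on `L` blocks of `R` elements (`R` a prime larger than `L`),
is followed at the level of blocks, with at most `2 * L` exceptions, by a permutation with a
single cycle. -/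
theorem exists_single_cycle_blocks {L R : ℕ} (hL : 0 < L) (hR : R.Prime) (hLR : L < R)
    (π : Perm (Fin L)) :
    ∃ ρ : Perm (Fin (L * R)), (∀ v w, ρ.SameCycle v w) ∧
      #{w | (ρ w).divNat ≠ π w.divNat} ≤ 2 * L := by
  classical
  have : Fact R.Prime := ⟨hR⟩
  have : NeZero R := ⟨hR.ne_zero⟩
  have : Nonempty (Fin L) := ⟨⟨0, hL⟩⟩
  -- `τ` follows `π` on blocks and advances the position inside the block. Its cycles all meet the
  -- `L` points at position `0`.
  let τ : Perm (Fin L × ZMod R) := prodCongr π (Equiv.addRight (1 : ZMod R))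
  let C : Finset (Fin L × ZMod R) := Finset.univ.map ⟨fun u => (u, 0), fun u v h => (Prod.ext_iff.1 h).1⟩
  have hfac : ((L.factorial : ℕ) : ZMod R) ≠ 0 := by
    rw [Ne, ZMod.natCast_eq_zero_iff, hR.dvd_factorial]
    omega
  have hpow : π ^ L.factorial = 1 := by
    have := pow_card_eq_one' (G := Perm (Fin L)) (x := π)
    rwa [Nat.card_eq_fintype_card, Fintype.card_perm, Fintype.card_fin] at this
  obtain ⟨ρ, h1, h2⟩ := exists_single_cycle_near C (by simp [C]) τ (by
    rintro ⟨u, t⟩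
    -- As `π ^ L! = 1`, a multiple `L! * k` of steps leads from `(u, 0)` to `(u, L! * k)`. Since `R`
    -- is a prime above `L`, `L!` is invertible modulo `R`, and `k = t / L!` reaches `t`.
    refine ⟨(u, 0), Finset.mem_map.2 ⟨u, Finset.mem_univ _, rfl⟩, ((L.factorial * (t / (L.factorial : ZMod R)).val : ℕ) : ℤ), ?_⟩
    rw [zpow_natCast, prodCongr_addRight_pow, pow_mul, hpow, one_pow]
    simp only [Perm.coe_one, id_eq, Nat.cast_mul, ZMod.natCast_val, ZMod.cast_id', zero_add]
    rw [mul_div_cancel₀ _ hfac])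
  let f : Fin L × ZMod R ≃ Fin (L * R) :=
    (prodCongr (Equiv.refl _) (Fintype.equivFinOfCardEq (ZMod.card R))).trans finProdFinEquiv
  have hf : ∀ w, (f.symm w).1 = w.divNat := fun w => rfl
  refine ⟨f.permCongr ρ, fun v w => ?_, ?_⟩
  · obtain ⟨i, hi, hi'⟩ := (h1 (f.symm v) (f.symm w)).exists_pow_eq'
    refine ⟨i, ?_⟩
    have : ∀ n : ℕ, (f.permCongr ρ) ^ n = f.permCongr (ρ ^ n) := fun n =>
      (map_pow f.permCongrHom ρ n).symm
    rw [zpow_natCast, this, Equiv.permCongr_apply, hi', Equiv.apply_symm_apply]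
  · have hC : #C = L := by simp [C]
    rw [hC] at h2
    refine le_trans ?_ h2
    rw [← Finset.card_map f.toEmbedding]
    refine Finset.card_le_card fun w hw => ?_
    simp only [Finset.mem_map_equiv, Finset.mem_filter, Finset.mem_univ, true_and] at hw ⊢
    intro hcon
    apply hw
    rw [← hf, Equiv.permCongr_apply, Equiv.symm_apply_apply, hcon, ← hf]
    rfl

/-- Among the permutations there is one whose cost is at most the average cost with respect to a
doubly stochastic matrix. -/
theorem exists_perm_sum_le {n : Type*} [Fintype n] [DecidableEq n] {M : Matrix n n ℝ}
    (hM : M ∈ doublyStochastic ℝ n) (c : n → n → ℝ) :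
    ∃ σ : Perm n, ∑ i, c i (σ i) ≤ ∑ i, ∑ j, M i j * c i j := by
  -- Birkhoff: the cost is linear in the matrix, hence is a weighted average of the costs of
  -- permutations, which cannot all exceed it.
  obtain ⟨w, hw0, hw1, rfl⟩ := exists_eq_sum_perm_of_mem_doublyStochastic hM
  by_contra! hcon
  have key : ∑ i, ∑ j, (∑ σ, w σ • Perm.permMatrix ℝ σ) i j * c i j
      = ∑ σ : Perm n, w σ * ∑ i, c i (σ i) := by
    simp only [Matrix.sum_apply, Matrix.smul_apply, Perm.permMatrix, PEquiv.toMatrix_apply,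
      Equiv.toPEquiv_apply, smul_eq_mul, Finset.sum_mul, Option.mem_def, Option.some.injEq]
    calc _ = ∑ i, ∑ σ : Perm n, ∑ j, w σ * (if σ i = j then 1 else 0) * c i j :=
          Finset.sum_congr rfl fun i _ => Finset.sum_comm
      _ = ∑ σ : Perm n, ∑ i, w σ * c i (σ i) := by
          rw [Finset.sum_comm]
          simp
      _ = _ := by simp [Finset.mul_sum]
  rw [key] at hcon
  have h3 : ∑ σ : Perm n, w σ * (∑ σ' : Perm n, w σ' * ∑ i, c i (σ' i))
      < ∑ σ : Perm n, w σ * ∑ i, c i (σ i) := by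
    refine Finset.sum_lt_sum (fun σ _ => mul_le_mul_of_nonneg_left (hcon σ).le (hw0 σ)) ?_
    obtain ⟨σ, -, hσ⟩ := Finset.exists_ne_zero_of_sum_ne_zero (by rw [hw1]; exact one_ne_zero)
    exact ⟨σ, Finset.mem_univ _, mul_lt_mul_of_pos_left (hcon σ) ((hw0 σ).lt_of_ne' hσ)⟩
  rw [← Finset.sum_mul, hw1, one_mul] at h3
  exact lt_irrefl _ h3

/-- Rounding of a substochastic matrix to a permutation of a set of twice the size. -/
theorem exists_perm_of_substochastic {M : ℕ} (m : Fin M → Fin M → ℝ) (hm : ∀ u v, 0 ≤ m u v)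
    (hrow : ∀ u, ∑ v, m u v ≤ 1) (hcol : ∀ v, ∑ u, m u v ≤ 1) {ι : Type*} (s : Finset ι)
    (g e : ι → Finset ℕ) (hg : ∀ i, g i ⊆ Finset.range M) (he : ∀ i, e i ⊆ Finset.range M) :
    ∃ π : Perm (Fin (M + M)),
      ∑ i ∈ s, (#{u : Fin (M + M) | ¬ ((u : ℕ) ∈ g i ↔ (π u : ℕ) ∈ e i)} : ℝ) ≤
      ∑ i ∈ s, ((#(g i) : ℝ) + #(e i) - 2 * ∑ u : Fin M, ∑ v : Fin M,
        if (u : ℕ) ∈ g i ∧ (v : ℕ) ∈ e i then m u v else 0) := by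
  classical
  -- The diagonal blocks hold `m` and its transpose; the off-diagonal ones hold the row and column
  -- deficits, so all rows and columns sum to one.
  let A : Matrix (Fin M ⊕ Fin M) (Fin M ⊕ Fin M) ℝ := Matrix.fromBlocks (Matrix.of m)
    (Matrix.diagonal fun u => 1 - ∑ v, m u v) (Matrix.diagonal fun v => 1 - ∑ u, m u v)
    (Matrix.of m).transpose
  have hA : A ∈ doublyStochastic ℝ (Fin M ⊕ Fin M) := by
    rw [mem_doublyStochastic_iff_sum]
    refine ⟨?_, ?_, ?_⟩
    · rintro (u | u) (v | v)
      · exact hm u v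
      · simp only [A, Matrix.fromBlocks_apply₁₂, Matrix.diagonal_apply]
        split_ifs
        · linarith [hrow u]
        · exact le_rfl
      · simp only [A, Matrix.fromBlocks_apply₂₁, Matrix.diagonal_apply]
        split_ifs
        · linarith [hcol u]
        · exact le_rfl
      · exact hm v u
    · rintro (u | u) <;> simp [A, Matrix.diagonal_apply, Fintype.sum_sum_type]
    · rintro (u | u) <;> simp [A, Matrix.diagonal_apply, Fintype.sum_sum_type]
  let f : Fin M ⊕ Fin M ≃ Fin (M + M) := finSumFinEquiv
  let k : ι → Fin M ⊕ Fin M → Fin M ⊕ Fin M → ℝ := fun i z z' =>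
    if ((f z : ℕ) ∈ g i ↔ (f z' : ℕ) ∈ e i) then 0 else 1
  obtain ⟨σ, hσ⟩ := exists_perm_sum_le hA fun z z' => ∑ i ∈ s, k i z z'
  refine ⟨f.permCongr σ, ?_⟩
  have h1 : ∑ i ∈ s, (#{u : Fin (M + M) | ¬ ((u : ℕ) ∈ g i ↔ (f.permCongr σ u : ℕ) ∈ e i)} : ℝ)
      = ∑ z, ∑ i ∈ s, k i z (σ z) := by
    rw [Finset.sum_comm]
    refine Finset.sum_congr rfl fun i _ => ?_
    rw [Finset.card_filter, Nat.cast_sum, ← Equiv.sum_comp f]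
    refine Finset.sum_congr rfl fun z _ => ?_
    simp only [Equiv.permCongr_apply, Equiv.symm_apply_apply, k]
    split_ifs <;> simp_all
  rw [h1]
  refine hσ.trans (le_of_eq ?_)
  simp only [Finset.mul_sum]
  rw [Finset.sum_congr rfl fun z _ => Finset.sum_comm, Finset.sum_comm]
  refine Finset.sum_congr rfl fun i _ => ?_
  have hfl : ∀ u : Fin M, (f (Sum.inl u) : ℕ) = u := fun u => by simp [f]
  -- The `M` added indices lie in none of the sets, so the transposed block costs nothing.
  have hrg : ∀ u : Fin M, ((f (Sum.inr u) : ℕ) ∈ g i) = False := fun u => by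
    simp only [f, finSumFinEquiv_apply_right, Fin.val_natAdd, eq_iff_iff, iff_false]
    intro h
    have := Finset.mem_range.1 (hg i h)
    omega
  have hre : ∀ u : Fin M, ((f (Sum.inr u) : ℕ) ∈ e i) = False := fun u => by
    simp only [f, finSumFinEquiv_apply_right, Fin.val_natAdd, eq_iff_iff, iff_false]
    intro h
    have := Finset.mem_range.1 (he i h)
    omega
  have hcard : ∀ t : Finset ℕ, t ⊆ Finset.range M →
      (#t : ℝ) = ∑ u : Fin M, if (u : ℕ) ∈ t then 1 else 0 := by
    intro t ht
    rw [Fin.sum_univ_eq_sum_range (fun u => if u ∈ t then (1 : ℝ) else 0), Finset.sum_ite_mem,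
      Finset.inter_eq_right.2 ht]
    simp
  rw [hcard _ (hg i), hcard _ (he i)]
  simp only [Fintype.sum_sum_type, A, Matrix.fromBlocks_apply₁₁, Matrix.fromBlocks_apply₁₂,
    Matrix.fromBlocks_apply₂₁, Matrix.fromBlocks_apply₂₂, k, hfl, hrg, hre, Matrix.diagonal_apply,
    Matrix.of_apply, Matrix.transpose_apply]
  have e1 : ∀ u : Fin M, ∑ v : Fin M, (if u = v then 1 - ∑ w, m u w else 0) *
      (if ((u : ℕ) ∈ g i ↔ False) then (0 : ℝ) else 1) =
      (if (u : ℕ) ∈ g i then 1 else 0) - ∑ v, if (u : ℕ) ∈ g i then m u v else 0 := by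
    intro u
    by_cases hu : (u : ℕ) ∈ g i <;> simp [hu]
  have e2 : ∀ u : Fin M, ∑ v : Fin M, (if u = v then 1 - ∑ w, m w u else 0) *
      (if (False ↔ (v : ℕ) ∈ e i) then (0 : ℝ) else 1) =
      (if (u : ℕ) ∈ e i then 1 else 0) - ∑ v, if (u : ℕ) ∈ e i then m v u else 0 := by
    intro u
    rw [Finset.sum_eq_single u (fun v _ hv => by rw [if_neg hv.symm, zero_mul]) (by simp)]
    by_cases hu : (u : ℕ) ∈ e i <;> simp [hu]
  simp only [e1, e2, Finset.sum_add_distrib, Finset.sum_sub_distrib, if_true, mul_zero,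
    Finset.sum_const_zero, add_zero]
  have e3 : ∑ u : Fin M, ∑ v : Fin M, (if (u : ℕ) ∈ e i then m v u else 0) =
    ∑ u : Fin M, ∑ v : Fin M, (if (v : ℕ) ∈ e i then m u v else 0) := Finset.sum_comm
  -- The indicator of disagreement is `1_g + 1_e - 2 * 1_g * 1_e`. The first two terms cancel
  -- against the deficits in `e1` and `e2`.
  have e4 : ∑ u : Fin M, ∑ v : Fin M, m u v *
      (if ((u : ℕ) ∈ g i ↔ (v : ℕ) ∈ e i) then (0 : ℝ) else 1) =
      ∑ u : Fin M, ∑ v : Fin M, (if (u : ℕ) ∈ g i then m u v else 0)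
      + ∑ u : Fin M, ∑ v : Fin M, (if (v : ℕ) ∈ e i then m u v else 0)
      - 2 * ∑ u : Fin M, ∑ v : Fin M, if (u : ℕ) ∈ g i ∧ (v : ℕ) ∈ e i then m u v else 0 := by
    rw [Finset.mul_sum, ← Finset.sum_add_distrib, ← Finset.sum_sub_distrib]
    refine Finset.sum_congr rfl fun u _ => ?_
    rw [Finset.mul_sum, ← Finset.sum_add_distrib, ← Finset.sum_sub_distrib]
    refine Finset.sum_congr rfl fun v _ => ?_
    by_cases hu : (u : ℕ) ∈ g i <;> by_cases hv : (v : ℕ) ∈ e i <;> simp [hu, hv]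
    ring
  rw [e4, e3]
  simp only [← Finset.mul_sum]
  ring

end Combinatorics

/-! ### Grid sets and their density among the sets of finite measure. -/

section Grid

theorem measurableEmbedding_coe_nnreal : MeasurableEmbedding ((↑) : ℝ≥0 → ℝ) :=
  MeasurableEmbedding.subtype_coe measurableSet_Ici

theorem leb_apply (A : Set ℝ≥0) : leb A = volume ((↑) '' A : Set ℝ) :=
  measurableEmbedding_coe_nnreal.comap_apply _ _

/-- The union of the intervals `[n / N, (n + 1) / N)` with `n ∈ e`. -/
def grid (N : ℕ) (e : Set ℕ) : Set ℝ≥0 := {x | ⌊x * N⌋₊ ∈ e}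

theorem mem_grid {N : ℕ} {e : Set ℕ} {x : ℝ≥0} : x ∈ grid N e ↔ ⌊x * N⌋₊ ∈ e := Iff.rfl

theorem measurableSet_grid (N : ℕ) (e : Set ℕ) : MeasurableSet (grid N e) :=
  (Nat.measurable_floor.comp (measurable_id.mul_const _)) (MeasurableSet.of_discrete (s := e))

theorem leb_Ico (a b : ℝ≥0) : leb (Ico a b) = b - a := by
  rw [leb_apply]
  have : ((↑) '' Ico a b : Set ℝ) = Ico (a : ℝ) b := by
    ext y
    constructor
    · rintro ⟨x, ⟨h1, h2⟩, rfl⟩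
      exact ⟨by exact_mod_cast h1, by exact_mod_cast h2⟩
    · rintro ⟨h1, h2⟩
      have hy : 0 ≤ y := a.2.trans h1
      exact ⟨⟨y, hy⟩, ⟨h1, h2⟩, rfl⟩
  rw [this, Real.volume_Ico, ENNReal.ofReal_sub (b : ℝ) a.coe_nonneg, ENNReal.ofReal_coe_nnreal,
    ENNReal.ofReal_coe_nnreal]

theorem grid_singleton {N : ℕ} (hN : 0 < N) (n : ℕ) :
    grid N {n} = Ico ((n : ℝ≥0) / N) (((n + 1 : ℕ) : ℝ≥0) / N) := by
  have hN' : (0 : ℝ≥0) < N := by exact_mod_cast hN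
  ext x
  rw [mem_grid, mem_singleton_iff, Nat.floor_eq_iff zero_le, mem_Ico, div_le_iff₀ hN',
    lt_div_iff₀ hN']
  push_cast
  rfl

theorem leb_grid_singleton {N : ℕ} (hN : 0 < N) (n : ℕ) : leb (grid N {n}) = (N : ℝ≥0∞)⁻¹ := by
  have hN' : (N : ℝ≥0) ≠ 0 := by exact_mod_cast hN.ne'
  rw [grid_singleton hN, leb_Ico, ← ENNReal.coe_sub]
  have : ((n + 1 : ℕ) : ℝ≥0) / N - (n : ℝ≥0) / N = (N : ℝ≥0)⁻¹ := by
    rw [Nat.cast_add, add_div, add_tsub_cancel_left, Nat.cast_one, one_div]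
  rw [this, ENNReal.coe_inv hN', ENNReal.coe_natCast]

theorem grid_eq_biUnion (N : ℕ) (e : Set ℕ) : grid N e = ⋃ n ∈ e, grid N {n} := by
  ext x
  simp [mem_grid]

theorem disjoint_grid {N : ℕ} {e f : Set ℕ} (h : Disjoint e f) : Disjoint (grid N e) (grid N f) :=
  h.preimage _

theorem leb_inter_grid {N : ℕ} (e : Finset ℕ) (A : Set ℝ≥0) (hA : MeasurableSet A) :
    leb (A ∩ grid N e) = ∑ n ∈ e, leb (A ∩ grid N {n}) := by
  rw [grid_eq_biUnion, inter_iUnion₂]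
  exact measure_biUnion_finset (fun i _ j _ hij => (disjoint_grid (by simpa using hij)).mono
    inter_subset_right inter_subset_right) fun n _ => hA.inter (measurableSet_grid _ _)

theorem leb_grid {N : ℕ} (hN : 0 < N) (e : Finset ℕ) : leb (grid N e) = e.card * (N : ℝ≥0∞)⁻¹ := by
  have := leb_inter_grid (N := N) e univ MeasurableSet.univ
  simp only [univ_inter, leb_grid_singleton hN, Finset.sum_const, nsmul_eq_mul] at this
  exact this

theorem leb_grid_lt_top {N : ℕ} (hN : 0 < N) (e : Finset ℕ) : leb (grid N e) < ∞ := by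
  rw [leb_grid hN]
  exact ENNReal.mul_lt_top (ENNReal.natCast_lt_top _) (by simpa using hN)

theorem grid_mul {N R : ℕ} (hR : 0 < R) (e : Set ℕ) :
    grid N e = grid (N * R) {n | n / R ∈ e} := by
  have hR' : (R : ℝ≥0) ≠ 0 := by exact_mod_cast hR.ne'
  ext x
  rw [mem_grid, mem_grid, mem_ofPred_eq, ← Nat.floor_div_natCast, Nat.cast_mul, ← mul_assoc,
    mul_div_cancel_right₀ _ hR']

instance nullSingletonClass_leb : NullSingletonClass leb := ⟨fun x => by rw [leb_apply]; simp⟩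

theorem grid_Iio {N : ℕ} (hN : 0 < N) (k : ℕ) : grid N (Iio k) = Iio ((k : ℝ≥0) / N) := by
  have hN' : (0 : ℝ≥0) < N := by exact_mod_cast hN
  ext x
  rw [mem_grid, mem_Iio, mem_Iio, Nat.floor_lt zero_le, lt_div_iff₀ hN']

theorem leb_Iio (a : ℝ≥0) : leb (Iio a) = a := by
  have : Iio a = Ico 0 a := by ext; simp
  rw [this, leb_Ico]; simp

instance isFiniteMeasureOnCompacts_leb : IsFiniteMeasureOnCompacts leb := ⟨fun K hK => by
  obtain ⟨b, hb⟩ := hK.bddAbove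
  refine (measure_mono (t := Iio (b + 1)) fun x hx => (hb hx).trans_lt ?_).trans_lt ?_
  · exact lt_add_of_pos_right _ one_pos
  · rw [leb_Iio]; exact ENNReal.coe_lt_top⟩

/-- The family of all grid sets, bounded or not. -/
def gridSets : Set (Set ℝ≥0) := {A | ∃ (N : ℕ) (e : Set ℕ), 0 < N ∧ A = grid N e}

/-- Unbounded grid sets are admitted so that complements stay in the family. Scales `N` and `M` have
the common refinement `N * M`. -/
theorem isSetAlgebra_gridSets : IsSetAlgebra gridSets where
  empty_mem := ⟨1, ∅, one_pos, rfl⟩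
  compl_mem := by
    rintro _ ⟨N, e, hN, rfl⟩
    exact ⟨N, eᶜ, hN, rfl⟩
  union_mem := by
    rintro _ _ ⟨N, e, hN, rfl⟩ ⟨M, f, hM, rfl⟩
    refine ⟨N * M, {n | n / M ∈ e} ∪ {n | n / N ∈ f}, Nat.mul_pos hN hM, ?_⟩
    rw [grid_mul hM e, grid_mul hN f, mul_comm M N]
    rfl

theorem exists_nat_div_near {a b : ℝ≥0} (h : a < b) :
    ∃ N k : ℕ, 0 < N ∧ a < (k : ℝ≥0) / N ∧ (k : ℝ≥0) / N < b := by
  obtain ⟨N, hN⟩ := exists_nat_gt (b - a)⁻¹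
  have hba : 0 < b - a := tsub_pos_of_lt h
  have hN0 : (0 : ℝ≥0) < N := (inv_pos.2 hba).trans hN
  refine ⟨N, ⌊a * N⌋₊ + 1, by exact_mod_cast hN0, ?_, ?_⟩
  · rw [lt_div_iff₀ hN0]
    exact_mod_cast Nat.lt_floor_add_one (a * N)
  · have h1 : 1 < (b - a) * N := by rwa [inv_lt_iff_one_lt_mul₀ hba, mul_comm] at hN
    have h2 : (⌊a * N⌋₊ : ℝ≥0) ≤ a * N := Nat.floor_le zero_le
    rw [div_lt_iff₀ hN0]
    calc ((⌊a * N⌋₊ + 1 : ℕ) : ℝ≥0) = ⌊a * N⌋₊ + 1 := by push_cast; rfl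
      _ < a * N + (b - a) * N := add_lt_add_of_le_of_lt h2 h1
      _ = b * N := by rw [← add_mul, add_tsub_cancel_of_le h.le]

theorem generateFrom_gridSets :
    (inferInstance : MeasurableSpace ℝ≥0) = MeasurableSpace.generateFrom gridSets := by
  apply le_antisymm
  · have h : (inferInstance : MeasurableSpace ℝ≥0) = MeasurableSpace.generateFrom (range Iio) :=
      BorelSpace.measurable_eq.trans (borel_eq_generateFrom_Iio _)
    rw [h]
    refine MeasurableSpace.generateFrom_le ?_
    rintro _ ⟨b, rfl⟩
    -- A ray is a countable union of rays with rational endpoints, which are grid sets.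
    have : Iio b = ⋃ (N : ℕ) (k : ℕ) (_ : 0 < N ∧ (k : ℝ≥0) / N ≤ b), grid N (Iio k) := by
      ext x
      simp only [mem_Iio, mem_iUnion, exists_prop]
      constructor
      · intro hx
        obtain ⟨N, k, hN, h1, h2⟩ := exists_nat_div_near hx
        exact ⟨N, k, ⟨hN, h2.le⟩, by rw [grid_Iio hN]; exact h1⟩
      · rintro ⟨N, k, ⟨hN, h1⟩, h2⟩
        rw [grid_Iio hN] at h2
        exact lt_of_lt_of_le h2 h1
    rw [this]
    refine MeasurableSet.iUnion fun N => MeasurableSet.iUnion fun k => MeasurableSet.iUnion fun h => ?_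
    exact MeasurableSpace.measurableSet_generateFrom ⟨N, _, h.1, rfl⟩
  · refine MeasurableSpace.generateFrom_le ?_
    rintro _ ⟨N, e, -, rfl⟩
    exact measurableSet_grid N e

theorem measureDense_gridSets : leb.MeasureDense gridSets :=
  Measure.MeasureDense.of_generateFrom_isSetAlgebra_sigmaFinite isSetAlgebra_gridSets
    { set := fun n => grid 1 (Iio n)
      set_mem := fun n => ⟨1, _, one_pos, rfl⟩
      finite := fun n => by rw [grid_Iio one_pos, leb_Iio]; exact ENNReal.coe_lt_top
      spanning := by
        refine eq_univ_of_forall fun x => mem_iUnion.2 ⟨⌊x⌋₊ + 1, ?_⟩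
        simp [mem_grid] } generateFrom_gridSets

/-- Bounded grid sets are dense in the Borel sets of finite measure. -/
theorem exists_grid_near {A : Set ℝ≥0} (hA : MeasurableSet A) (hA' : leb A < ∞) {ε : ℝ}
    (hε : 0 < ε) :
    ∃ (N : ℕ) (e : Finset ℕ), 0 < N ∧ leb (A ∆ grid N e) < ENNReal.ofReal ε := by
  obtain ⟨_, ⟨N, e, hN, rfl⟩, he⟩ := measureDense_gridSets.approx A hA hA'.ne ε hε
  have hfin : leb (A ∆ grid N e) ≠ ∞ := he.ne_top
  have hmono : Antitone fun k : ℕ => A \ grid N (Iio k) := fun k l hkl x hx =>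
    ⟨hx.1, fun h => hx.2 (lt_of_lt_of_le h hkl)⟩
  have hlim := tendsto_measure_iInter_atTop (μ := leb) (s := fun k : ℕ => A \ grid N (Iio k))
    (fun k => (hA.diff (measurableSet_grid _ _)).nullMeasurableSet) hmono
    ⟨0, (measure_mono sdiff_subset |>.trans_lt hA').ne⟩
  have hempty : ⋂ k : ℕ, A \ grid N (Iio k) = ∅ := by
    refine eq_empty_of_forall_notMem fun x hx => ?_
    exact (mem_iInter.1 hx (⌊x * N⌋₊ + 1)).2 (by simp [mem_grid])
  rw [hempty, measure_empty] at hlim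
  -- The slack in `he` leaves room for the part of `A` beyond `k / N`, which is lost when the grid
  -- set is truncated.
  obtain ⟨k, hk⟩ := (hlim.eventually (gt_mem_nhds (tsub_pos_of_lt he))).exists
  classical
  refine ⟨N, {n ∈ Finset.range k | n ∈ e}, hN, ?_⟩
  have hsub : A ∆ grid N (({n ∈ Finset.range k | n ∈ e} : Finset ℕ) : Set ℕ) ⊆
      (A ∆ grid N e) ∪ (A \ grid N (Iio k)) := by
    intro x
    simp only [mem_symmDiff, mem_grid, mem_union, mem_sdiff, Finset.coe_filter, mem_ofPred_eq,
      Finset.mem_range, mem_Iio]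
    tauto
  calc _ ≤ leb (A ∆ grid N e) + leb (A \ grid N (Iio k)) :=
        (measure_mono hsub).trans (measure_union_le _ _)
    _ < leb (A ∆ grid N e) + (ENNReal.ofReal ε - leb (A ∆ grid N e)) :=
        ENNReal.add_lt_add_left hfin hk
    _ = ENNReal.ofReal ε := add_tsub_cancel_of_le he.le

/-- Finitely many Borel sets of finite measure can be approximated by grid sets of one scale. -/
theorem exists_common_grid_near {ι : Type*} [Fintype ι] {A : ι → Set ℝ≥0}
    (hA : ∀ i, MeasurableSet (A i)) (hA' : ∀ i, leb (A i) < ∞) {ε : ℝ} (hε : 0 < ε) :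
    ∃ (N M : ℕ) (e : ι → Finset ℕ), 0 < N ∧ 0 < M ∧ (∀ i, e i ⊆ Finset.range M) ∧
      ∀ i, leb (A i ∆ grid N (e i)) < ENNReal.ofReal ε := by
  classical
  choose N e hN he using fun i => exists_grid_near (hA i) (hA' i) hε
  -- The common scale is the product of all scales; each grid set is refined by the product of the
  -- others.
  have hdvd : ∀ i, N i * (∏ j ∈ Finset.univ.erase i, N j) = ∏ j, N j := fun i =>
    Finset.mul_prod_erase _ _ (Finset.mem_univ i)
  have hR : ∀ i, 0 < ∏ j ∈ Finset.univ.erase i, N j := fun i => Finset.prod_pos fun j _ => hN j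
  have hfin : ∀ i, {n : ℕ | n / (∏ j ∈ Finset.univ.erase i, N j) ∈ e i}.Finite := fun i => by
    refine Set.Finite.subset (Finset.finite_toSet (Finset.range
      ((∏ j ∈ Finset.univ.erase i, N j) * ((e i).sup id + 1)))) fun n hn => ?_
    rw [Finset.mem_coe, Finset.mem_range]
    have h1 : n / (∏ j ∈ Finset.univ.erase i, N j) ≤ (e i).sup id := Finset.le_sup (f := id) hn
    rw [mul_comm]
    exact (Nat.div_lt_iff_lt_mul (hR i)).1 (Nat.lt_succ_of_le h1)
  let e' : ι → Finset ℕ := fun i => (hfin i).toFinset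
  refine ⟨∏ j, N j, (Finset.univ.biUnion e').sup id + 1, e', Finset.prod_pos fun j _ => hN j,
    Nat.succ_pos _, fun i n hn => ?_, fun i => ?_⟩
  · rw [Finset.mem_range, Nat.lt_succ_iff]
    exact Finset.le_sup (f := id) (Finset.mem_biUnion.2 ⟨i, Finset.mem_univ _, hn⟩)
  · have := he i
    rw [grid_mul (hR i), hdvd] at this
    simpa [e'] using this

end Grid

/-! ### Interval exchanges that permute the cells of a grid. -/

section CellPerm
open Equiv

/-- The interval exchange that permutes the intervals `[n / N, (n + 1) / N)` according to `ρ`. -/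
noncomputable def cellMap (N : ℕ) (ρ : Perm ℕ) (x : ℝ≥0) : ℝ≥0 :=
  ((ρ ⌊x * N⌋₊ : ℝ≥0) + (x * N - ⌊x * N⌋₊)) / N

theorem cellMap_mul {N : ℕ} (hN : 0 < N) (ρ : Perm ℕ) (x : ℝ≥0) :
    cellMap N ρ x * N = (ρ ⌊x * N⌋₊ : ℝ≥0) + (x * N - ⌊x * N⌋₊) :=
  div_mul_cancel₀ _ (by exact_mod_cast hN.ne')

theorem floor_cellMap {N : ℕ} (hN : 0 < N) (ρ : Perm ℕ) (x : ℝ≥0) :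
    ⌊cellMap N ρ x * N⌋₊ = ρ ⌊x * N⌋₊ := by
  rw [cellMap_mul hN, Nat.floor_eq_iff zero_le]
  refine ⟨le_self_add, ?_⟩
  gcongr
  rw [tsub_lt_iff_left (Nat.floor_le zero_le)]
  exact Nat.lt_floor_add_one _

theorem cellMap_cellMap {N : ℕ} (hN : 0 < N) (σ ρ : Perm ℕ) (x : ℝ≥0) :
    cellMap N σ (cellMap N ρ x) = cellMap N (σ * ρ) x := by
  rw [cellMap, floor_cellMap hN, cellMap_mul hN, add_tsub_cancel_left, cellMap, Perm.mul_apply]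

theorem cellMap_one {N : ℕ} (hN : 0 < N) (x : ℝ≥0) : cellMap N 1 x = x := by
  rw [cellMap, Perm.one_apply, add_tsub_cancel_of_le (Nat.floor_le zero_le),
    mul_div_cancel_right₀ _ (by exact_mod_cast hN.ne')]

theorem measurable_cellMap (N : ℕ) (ρ : Perm ℕ) : Measurable (cellMap N ρ) := by
  have h : Measurable fun x : ℝ≥0 => ⌊x * N⌋₊ := Nat.measurable_floor.comp (measurable_id.mul_const _)
  exact (((measurable_from_nat (f := fun n => ((ρ n : ℕ) : ℝ≥0))).comp h).add
    ((measurable_id.mul_const _).sub ((measurable_from_nat (f := fun n => (n : ℝ≥0))).comp h))).div_const _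

theorem coe_cellMap {N : ℕ} (hN : 0 < N) (ρ : Perm ℕ) (x : ℝ≥0) :
    (cellMap N ρ x : ℝ) = x + ((ρ ⌊x * N⌋₊ : ℝ) - ⌊x * N⌋₊) / N := by
  have hN' : (N : ℝ) ≠ 0 := by exact_mod_cast hN.ne'
  rw [cellMap, NNReal.coe_div, NNReal.coe_add, NNReal.coe_sub (Nat.floor_le zero_le)]
  push_cast
  field_simp
  ring

theorem measurePreserving_cellMap {N : ℕ} (hN : 0 < N) (ρ : Perm ℕ) :
    MeasurePreserving (cellMap N ρ) leb leb := by
  refine ⟨measurable_cellMap N ρ, Measure.ext fun A hA => ?_⟩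
  rw [Measure.map_apply (measurable_cellMap N ρ) hA]
  have hdec : ∀ B : Set ℝ≥0, MeasurableSet B → leb B = ∑' n, leb (B ∩ grid N {n}) := by
    intro B hB
    rw [← measure_iUnion (fun i j hij => (disjoint_grid (by simpa using hij)).mono
      inter_subset_right inter_subset_right) fun n => hB.inter (measurableSet_grid _ _)]
    congr 1
    ext x
    simp [mem_grid]
  -- On the cell `n` the map is the translation by `(ρ n - n) / N`.
  have hcell : ∀ n, leb (cellMap N ρ ⁻¹' A ∩ grid N {n}) = leb (A ∩ grid N {ρ n}) := by
    intro n
    rw [leb_apply, leb_apply, ← measure_preimage_add_right volume (((ρ n : ℝ) - n) / N)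
      ((↑) '' (A ∩ grid N {ρ n}))]
    congr 1
    ext y
    constructor
    · rintro ⟨x, ⟨hx, hn⟩, rfl⟩
      have hn : ⌊x * N⌋₊ = n := hn
      refine ⟨cellMap N ρ x, ⟨hx, ?_⟩, ?_⟩
      · rw [mem_grid, floor_cellMap hN, hn]; rfl
      · rw [coe_cellMap hN, hn]
    · rintro ⟨z, ⟨hz, hn⟩, hzy⟩
      have hn : ⌊z * N⌋₊ = ρ n := hn
      refine ⟨cellMap N ρ⁻¹ z, ⟨?_, ?_⟩, ?_⟩
      · rw [mem_preimage, cellMap_cellMap hN, mul_inv_cancel, cellMap_one hN]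
        exact hz
      · simp [mem_grid, floor_cellMap hN, hn]
      · rw [coe_cellMap hN, hn, hzy]
        simp only [Perm.inv_def, Equiv.symm_apply_apply]
        ring
  rw [hdec _ (measurable_cellMap N ρ hA), hdec _ hA]
  simp_rw [hcell]
  exact Equiv.tsum_eq ρ fun n => leb (A ∩ grid N {n})

/-- The interval exchange `cellMap N ρ` as an element of `MPAut`. -/
noncomputable def cellPerm (N : ℕ) (hN : 0 < N) (ρ : Perm ℕ) : MPAut :=
  ⟨⟨cellMap N ρ, cellMap N ρ⁻¹,
    fun x => by rw [cellMap_cellMap hN, inv_mul_cancel, cellMap_one hN],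
    fun x => by rw [cellMap_cellMap hN, mul_inv_cancel, cellMap_one hN]⟩,
    measurePreserving_cellMap hN ρ, measurePreserving_cellMap hN ρ⁻¹⟩

theorem cellPerm_inv_toFun (N : ℕ) (hN : 0 < N) (ρ : Perm ℕ) :
    (cellPerm N hN ρ)⁻¹.toFun = cellMap N ρ⁻¹ :=
  rfl

theorem preimage_cellMap {N : ℕ} (hN : 0 < N) (ρ : Perm ℕ) (e : Set ℕ) :
    cellMap N ρ ⁻¹' grid N e = grid N (ρ ⁻¹' e) := by
  ext x
  rw [mem_preimage, mem_grid, floor_cellMap hN]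
  rfl

theorem iterate_cellMap_image {N : ℕ} (hN : 0 < N) (ρ : Perm ℕ) (n i : ℕ) :
    (cellPerm N hN ρ).toFun^[i] '' grid N {n} = grid N {(ρ ^ i) n} := by
  induction i with
  | zero => simp
  | succ i ih =>
    rw [Function.iterate_succ', image_comp, ih, MPAut.image_eq, cellPerm_inv_toFun,
      preimage_cellMap hN, pow_succ', Perm.mul_apply]
    congr 1
    ext m
    simp [Equiv.symm_apply_eq]

end CellPerm

/-! ### A pseudo-metric for the weak topology. -/

section WeakTopology
open Filter Topology

theorem leb_preimage_symmDiff {f : ℝ≥0 → ℝ≥0} (hf : MeasurePreserving f leb leb) {A B : Set ℝ≥0}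
    (hA : MeasurableSet A) (hB : MeasurableSet B) :
    leb ((f ⁻¹' A) ∆ (f ⁻¹' B)) = leb (A ∆ B) := by
  rw [← preimage_symmDiff]
  exact hf.measure_preimage (hA.symmDiff hB).nullMeasurableSet

theorem leb_symmDiff_triangle (A B C : Set ℝ≥0) : leb (A ∆ C) ≤ leb (A ∆ B) + leb (B ∆ C) :=
  measure_symmDiff_le A B C

/-- If `A` is near `B`, then `f⁻¹ A △ g⁻¹ A` is nearly as small as `f⁻¹ B △ g⁻¹ B`. -/
theorem leb_preimage_symmDiff_le {f g : ℝ≥0 → ℝ≥0} (hf : MeasurePreserving f leb leb)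
    (hg : MeasurePreserving g leb leb) {A B : Set ℝ≥0} (hA : MeasurableSet A)
    (hB : MeasurableSet B) :
    leb ((f ⁻¹' A) ∆ (g ⁻¹' A)) ≤ leb ((f ⁻¹' B) ∆ (g ⁻¹' B)) + 2 * leb (A ∆ B) := by
  calc _ ≤ leb ((f ⁻¹' A) ∆ (f ⁻¹' B)) + leb ((f ⁻¹' B) ∆ (g ⁻¹' A)) := leb_symmDiff_triangle _ _ _
    _ ≤ leb ((f ⁻¹' A) ∆ (f ⁻¹' B)) + (leb ((f ⁻¹' B) ∆ (g ⁻¹' B)) + leb ((g ⁻¹' B) ∆ (g ⁻¹' A))) := by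
        gcongr; exact leb_symmDiff_triangle _ _ _
    _ = _ := by
        rw [leb_preimage_symmDiff hf hA hB, leb_preimage_symmDiff hg hB hA, symmDiff_comm B A]
        ring

theorem MPAut.measurable (T : MPAut) : Measurable T.toFun := T.measurePreserving.measurable

theorem autDist_eq (A : Set ℝ≥0) (T S : MPAut) : autDist A T S =
    leb ((T⁻¹.toFun ⁻¹' A) ∆ (S⁻¹.toFun ⁻¹' A)) + leb ((T.toFun ⁻¹' A) ∆ (S.toFun ⁻¹' A)) := by
  rw [autDist, MPAut.image_eq, MPAut.image_eq, MPAut.image_eq, MPAut.image_eq, inv_inv, inv_inv]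

theorem weakDist_mk (A : Set ℝ≥0) (T S : MPAut) : weakDist A (T : MPGroup) S = autDist A T S := rfl

theorem weakDist_self (A : Set ℝ≥0) (T : MPGroup) : weakDist A T T = 0 := by
  induction T using QuotientGroup.induction_on with
  | H T => simp [weakDist_mk, autDist]

theorem weakDist_comm (A : Set ℝ≥0) (T S : MPGroup) : weakDist A T S = weakDist A S T := by
  induction T using QuotientGroup.induction_on with
  | H T =>
    induction S using QuotientGroup.induction_on with
    | H S =>
      rw [weakDist_mk, weakDist_mk, autDist, autDist, symmDiff_comm,
        symmDiff_comm (T⁻¹.toFun '' A)]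

theorem weakDist_triangle (A : Set ℝ≥0) (T S U : MPGroup) :
    weakDist A T U ≤ weakDist A T S + weakDist A S U := by
  induction T using QuotientGroup.induction_on with
  | H T =>
    induction S using QuotientGroup.induction_on with
    | H S =>
      induction U using QuotientGroup.induction_on with
      | H U =>
        simp only [weakDist_mk, autDist]
        rw [add_add_add_comm]
        exact add_le_add (leb_symmDiff_triangle _ _ _) (leb_symmDiff_triangle _ _ _)

/-- Each of the four sets in `weakDist` changes by the measure of `A ∆ B`. Hence a dense sequence of
sets suffices to describe the topology. -/
theorem weakDist_le {A B : Set ℝ≥0} (hA : MeasurableSet A) (hB : MeasurableSet B)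
    (T S : MPGroup) : weakDist A T S ≤ weakDist B T S + 4 * leb (A ∆ B) := by
  induction T using QuotientGroup.induction_on with
  | H T =>
    induction S using QuotientGroup.induction_on with
    | H S =>
      simp only [weakDist_mk, autDist_eq]
      refine (add_le_add
        (leb_preimage_symmDiff_le T⁻¹.measurePreserving S⁻¹.measurePreserving hA hB)
        (leb_preimage_symmDiff_le T.measurePreserving S.measurePreserving hA hB)).trans
        (le_of_eq ?_)
      ring

theorem weakDist_lt_mem_nhds (T : MPGroup) {A : Set ℝ≥0} (hA : MeasurableSet A) (hA' : leb A < ∞)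
    {ε : ℝ} (hε : 0 < ε) : {S | weakDist A T S < ENNReal.ofReal ε} ∈ 𝓝 T := by
  refine IsOpen.mem_nhds (TopologicalSpace.isOpen_generateFrom_of_mem ⟨T, A, ε, hA, hA', hε, rfl⟩) ?_
  rw [mem_ofPred_eq, weakDist_self]
  exact ENNReal.ofReal_pos.2 hε

/-- Bounded grid sets, in some order. -/
theorem exists_gridSeq : ∃ D : ℕ → Set ℝ≥0, IsDenseSeq D ∧
    ∀ (N : ℕ) (e : Finset ℕ), 0 < N → ∃ i, D i = grid N e := by
  obtain ⟨f, hf⟩ := exists_surjective_nat (ℕ × Finset ℕ)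
  have hgrid : ∀ (N : ℕ) (e : Finset ℕ), 0 < N → ∃ i, grid ((f i).1 + 1) (f i).2 = grid N e := by
    intro N e hN
    obtain ⟨i, hi⟩ := hf (N - 1, e)
    exact ⟨i, by rw [hi]; simp only; rw [Nat.sub_add_cancel hN]⟩
  refine ⟨fun i => grid ((f i).1 + 1) (f i).2, ⟨fun i => measurableSet_grid _ _,
    fun i => leb_grid_lt_top (Nat.succ_pos _) _, fun A hA hA' ε hε => ?_⟩, hgrid⟩
  obtain ⟨N, e, hN, he⟩ := exists_grid_near hA hA' hε
  obtain ⟨i, hi⟩ := hgrid N e hN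
  exact ⟨i, by simpa only [hi] using he⟩

/-- A pseudo-distance on `𝓜` that is built from the sets of a sequence. -/
@[reducible] noncomputable def weakEMetric (D : ℕ → Set ℝ≥0) : PseudoEMetricSpace MPGroup where
  -- The caps `2⁻¹ ^ i` leave only finitely many sets to control at a given precision; below its
  -- cap, a term is the plain `weakDist`.
  edist S T := ⨆ i, min (2⁻¹ ^ i) (weakDist (D i) S T)
  edist_self T := by simp [weakDist_self]
  edist_comm S T := by simp only [weakDist_comm _ S T]
  edist_triangle S T U := by
    refine iSup_le fun i => ?_
    calc _ ≤ min (2⁻¹ ^ i) (weakDist (D i) S T + weakDist (D i) T U) :=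
          min_le_min le_rfl (weakDist_triangle _ _ _ _)
      _ ≤ min (2⁻¹ ^ i) (weakDist (D i) S T) + min (2⁻¹ ^ i) (weakDist (D i) T U) := by
          rcases le_total (2⁻¹ ^ i) (weakDist (D i) S T) with h | h
          · rw [min_eq_left h]
            exact (min_le_left _ _).trans le_self_add
          · rcases le_total (2⁻¹ ^ i) (weakDist (D i) T U) with h' | h'
            · rw [min_eq_left h']
              exact (min_le_left _ _).trans le_add_self
            · rw [min_eq_right h, min_eq_right h']
              exact min_le_right _ _
      _ ≤ _ := add_le_add (le_iSup (fun i => min (2⁻¹ ^ i) (weakDist (D i) S T)) i)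
          (le_iSup (fun i => min (2⁻¹ ^ i) (weakDist (D i) T U)) i)

theorem weakDist_lt_of_edist_lt {D : ℕ → Set ℝ≥0} {S T : MPGroup} {i : ℕ} {ε : ℝ≥0∞}
    (h : (weakEMetric D).edist S T < ε) (hε : ε ≤ 2⁻¹ ^ i) : weakDist (D i) S T < ε := by
  have h1 : min (2⁻¹ ^ i) (weakDist (D i) S T) < ε :=
    (le_iSup (fun i => min (2⁻¹ ^ i) (weakDist (D i) S T)) i).trans_lt h
  rcases min_lt_iff.1 h1 with h2 | h2
  · exact absurd hε (not_le.2 h2)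
  · exact h2

/-- The pseudo-distance of a dense sequence induces the weak topology. -/
theorem weakTopology_eq {D : ℕ → Set ℝ≥0} (hD : IsDenseSeq D) :
    weakTopology = (weakEMetric D).toUniformSpace.toTopologicalSpace := by
  apply le_antisymm
  · intro U hU
    have hU' : ∀ T ∈ U, ∃ ε > 0, ∀ S, (weakEMetric D).edist S T < ε → S ∈ U := by
      intro T hT
      obtain ⟨ε, hε, h⟩ := (@EMetric.isOpen_iff _ (weakEMetric D) U).1 hU T hT
      exact ⟨ε, hε, fun S hS => h hS⟩
    refine isOpen_iff_mem_nhds.2 fun T hT => ?_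
    obtain ⟨ε, hε, h⟩ := hU' T hT
    obtain ⟨n, hn⟩ := ENNReal.exists_inv_two_pow_lt hε.ne'
    have hmem : ∀ᶠ S in 𝓝 T, ∀ i ∈ Finset.range n, weakDist (D i) T S < ENNReal.ofReal (2⁻¹ ^ n) :=
      (Finset.eventually_all _).2 fun i _ =>
        weakDist_lt_mem_nhds T (hD.measurable i) (hD.finite i) (by positivity)
    filter_upwards [hmem] with S hS
    refine h S (lt_of_le_of_lt (iSup_le fun i => ?_) hn)
    rcases lt_or_ge i n with hi | hi
    · refine (min_le_right _ _).trans ?_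
      rw [weakDist_comm]
      refine (hS i (Finset.mem_range.2 hi)).le.trans (le_of_eq ?_)
      rw [ENNReal.ofReal_pow (by norm_num), ENNReal.ofReal_inv_of_pos (by norm_num)]
      norm_num
    · refine (min_le_left _ _).trans ?_
      exact pow_le_pow_right_of_le_one' (by norm_num) hi
  · refine le_generateFrom ?_
    rintro _ ⟨T, A, ε, hA, hA', hε, rfl⟩
    refine (@EMetric.isOpen_iff _ (weakEMetric D) _).2 fun T' hT' => ?_
    have hT' : weakDist A T T' < ENNReal.ofReal ε := hT'
    -- A fifth of the available slack: one `δ` for the distance to `T'`, four for replacing `A` by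
    -- `D i`.
    obtain ⟨δ, hδ0, hδ⟩ : ∃ δ : ℝ, 0 < δ ∧
        weakDist A T T' + (ENNReal.ofReal δ + 4 * ENNReal.ofReal δ) ≤ ENNReal.ofReal ε := by
      have hx : (weakDist A T T').toReal < ε := ENNReal.toReal_lt_of_lt_ofReal hT'
      refine ⟨(ε - (weakDist A T T').toReal) / 5, by linarith, ?_⟩
      have hne : weakDist A T T' ≠ ∞ := hT'.ne_top
      rw [← ENNReal.ofReal_toReal hne, show (4 : ℝ≥0∞) = ENNReal.ofReal 4 by simp,
        ← ENNReal.ofReal_mul (by norm_num), ENNReal.toReal_ofReal ENNReal.toReal_nonneg,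
        ← ENNReal.ofReal_add (by linarith) (by linarith),
        ← ENNReal.ofReal_add ENNReal.toReal_nonneg (by linarith)]
      exact ENNReal.ofReal_le_ofReal (by linarith)
    obtain ⟨i, hi⟩ := hD.dense A hA hA' δ hδ0
    refine ⟨min (2⁻¹ ^ i) (ENNReal.ofReal δ),
      lt_min (ENNReal.pow_pos (by norm_num) _) (ENNReal.ofReal_pos.2 hδ0), fun S hS => ?_⟩
    have hS : (weakEMetric D).edist S T' < min (2⁻¹ ^ i) (ENNReal.ofReal δ) := hS
    have h1 := (weakDist_lt_of_edist_lt hS (min_le_left _ _)).trans_le (min_le_right _ _)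
    rw [weakDist_comm] at h1
    change weakDist A T S < ENNReal.ofReal ε
    refine lt_of_lt_of_le ?_ hδ
    refine (weakDist_triangle A T T' S).trans_lt (ENNReal.add_lt_add_left hT'.ne_top ?_)
    refine (weakDist_le hA (hD.measurable i) T' S).trans_lt (ENNReal.add_lt_add h1 ?_)
    exact (ENNReal.mul_lt_mul_iff_right (by norm_num) (by norm_num)).2 hi

end WeakTopology

/-! ### Openness of `approxSet A j`, and rank-one transformations from the intersection. -/

section Open
open Filter Topology

theorem exists_weakDist_of_mem_nhds {D : ℕ → Set ℝ≥0} (hD : IsDenseSeq D) {T : MPGroup}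
    {U : Set MPGroup} (hU : U ∈ 𝓝 T) :
    ∃ (n : ℕ) (ε : ℝ), 0 < ε ∧ ∀ S, (∀ i < n, weakDist (D i) T S < ENNReal.ofReal ε) → S ∈ U := by
  obtain ⟨V, hVU, hV, hT⟩ := mem_nhds_iff.1 hU
  rw [weakTopology_eq hD] at hV
  obtain ⟨ε, hε, h⟩ := (@EMetric.isOpen_iff _ (weakEMetric D) V).1 hV T hT
  obtain ⟨n, hn⟩ := ENNReal.exists_inv_two_pow_lt hε.ne'
  refine ⟨n, 2⁻¹ ^ n, by positivity, fun S hS => hVU (h ?_)⟩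
  change (weakEMetric D).edist S T < ε
  refine lt_of_le_of_lt (iSup_le fun i => ?_) hn
  rcases lt_or_ge i n with hi | hi
  · refine (min_le_right _ _).trans ?_
    rw [weakDist_comm]
    refine (hS i hi).le.trans (le_of_eq ?_)
    rw [ENNReal.ofReal_pow (by norm_num), ENNReal.ofReal_inv_of_pos (by norm_num)]
    norm_num
  · exact (min_le_left _ _).trans (pow_le_pow_right_of_le_one' (by norm_num) hi)

theorem MPAut.measurableSet_image (T : MPAut) {A : Set ℝ≥0} (hA : MeasurableSet A) :
    MeasurableSet (T.toFun '' A) := by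
  rw [T.image_eq]
  exact T⁻¹.measurable hA

theorem MPAut.leb_image (T : MPAut) {A : Set ℝ≥0} (hA : MeasurableSet A) :
    leb (T.toFun '' A) = leb A := by
  rw [T.image_eq]
  exact T⁻¹.measurePreserving.measure_preimage hA.nullMeasurableSet

theorem MPAut.leb_image_symmDiff (T : MPAut) {A B : Set ℝ≥0} (hA : MeasurableSet A)
    (hB : MeasurableSet B) : leb ((T.toFun '' A) ∆ (T.toFun '' B)) = leb (A ∆ B) := by
  rw [T.image_eq, T.image_eq]
  exact leb_preimage_symmDiff T⁻¹.measurePreserving hA hB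

theorem MPAut.measurableSet_iterate_image (T : MPAut) (k : ℕ) {A : Set ℝ≥0}
    (hA : MeasurableSet A) : MeasurableSet (T.toFun^[k] '' A) := by
  rw [← MPAut.toFun_pow]
  exact (T ^ k).measurableSet_image hA

theorem MPAut.leb_iterate_image (T : MPAut) (k : ℕ) {A : Set ℝ≥0} (hA : MeasurableSet A) :
    leb (T.toFun^[k] '' A) = leb A := by
  rw [← MPAut.toFun_pow]
  exact (T ^ k).leb_image hA

/-- Errors add up: `S` preserves the error already made, and each step adds the discrepancy of `T`
and `S` on one level of the column of `T`. -/
theorem leb_iterate_symmDiff_le {T S : MPAut} {B : Set ℝ≥0} (hB : MeasurableSet B) {η : ℝ≥0∞}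
    (k : ℕ) (h : ∀ l < k, autDist (T.toFun^[l] '' B) T S ≤ η) :
    leb ((T.toFun^[k] '' B) ∆ (S.toFun^[k] '' B)) ≤ k * η := by
  induction k with
  | zero => simp
  | succ k ih =>
    have ih := ih fun l hl => h l (hl.trans (Nat.lt_succ_self k))
    rw [Function.iterate_succ', image_comp, Function.iterate_succ', image_comp]
    calc _ ≤ leb ((T.toFun '' (T.toFun^[k] '' B)) ∆ (S.toFun '' (T.toFun^[k] '' B)))
          + leb ((S.toFun '' (T.toFun^[k] '' B)) ∆ (S.toFun '' (S.toFun^[k] '' B))) :=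
          leb_symmDiff_triangle _ _ _
      _ ≤ η + k * η := by
          rw [S.leb_image_symmDiff (T.measurableSet_iterate_image k hB)
            (S.measurableSet_iterate_image k hB)]
          exact add_le_add (le_self_add.trans (h k (Nat.lt_succ_self k))) ih
      _ = _ := by push_cast; ring

theorem biUnion_symmDiff_subset {α : Type*} (E : Finset ℕ) (f g : ℕ → Set α) :
    (⋃ i ∈ E, f i) ∆ (⋃ i ∈ E, g i) ⊆ ⋃ i ∈ E, f i ∆ g i := by
  intro x
  simp only [mem_symmDiff, mem_iUnion, exists_prop, not_exists, not_and]
  rintro (⟨⟨i, hi, hx⟩, h⟩ | ⟨⟨i, hi, hx⟩, h⟩)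
  · exact ⟨i, hi, Or.inl ⟨hx, h i hi⟩⟩
  · exact ⟨i, hi, Or.inr ⟨hx, h i hi⟩⟩

/-- A column of `T` is near a column of any `S` that moves its levels in nearly the same way. -/
theorem exists_column_near {T S : MPAut} {B : Set ℝ≥0} {h : ℕ} (hB : IsColumn T B h) {η : ℝ≥0∞}
    (hη : ∀ l < h, autDist (T.toFun^[l] '' B) T S ≤ η) :
    ∃ B' : Set ℝ≥0, IsColumn S B' h ∧ ∀ E : Finset ℕ, (∀ i ∈ E, i < h) →
      leb ((⋃ i ∈ E, T.toFun^[i] '' B) ∆ ⋃ i ∈ E, S.toFun^[i] '' B') ≤ h * (h * η + h * (h * η)) := by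
  have hBm := hB.measurable_base
  have hk : ∀ k < h, leb ((T.toFun^[k] '' B) ∆ (S.toFun^[k] '' B)) ≤ h * η := fun k hk =>
    (leb_iterate_symmDiff_le hBm k fun l hl => hη l (hl.trans hk)).trans (by gcongr)
  have hSm : ∀ k, Measurable (S.toFun^[k]) := fun k => by
    rw [← MPAut.toFun_pow]; exact (S ^ k).measurable
  -- Keep the points whose first `h` positions under `S` lie in the corresponding levels of `T`. The
  -- levels of `S` are then disjoint because those of `T` are.
  let B' : Set ℝ≥0 := B ∩ ⋂ k ∈ Finset.range h, S.toFun^[k] ⁻¹' (T.toFun^[k] '' B)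
  have hB'm : MeasurableSet B' := hBm.inter (Finset.measurableSet_biInter _ fun k _ =>
    hSm k (T.measurableSet_iterate_image k hBm))
  have hsub : ∀ k < h, S.toFun^[k] '' B' ⊆ T.toFun^[k] '' B := by
    rintro k hk _ ⟨x, hx, rfl⟩
    exact mem_iInter₂.1 hx.2 k (Finset.mem_range.2 hk)
  have hdiff : leb (B \ B') ≤ h * (h * η) := by
    have h1 : B \ B' ⊆ ⋃ k ∈ Finset.range h, B \ S.toFun^[k] ⁻¹' (T.toFun^[k] '' B) := by
      intro x hx
      have h2 := hx.2
      simp only [B', mem_inter_iff, hx.1, true_and, mem_iInter, not_forall] at h2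
      obtain ⟨k, hk, h3⟩ := h2
      exact mem_iUnion₂.2 ⟨k, hk, hx.1, h3⟩
    refine (measure_mono h1).trans ((measure_biUnion_finset_le _ _).trans ?_)
    refine (Finset.sum_le_card_nsmul _ _ (h * η) fun k hk' => ?_).trans (le_of_eq ?_)
    · rw [← S.leb_iterate_image k (hBm.diff (hSm k (T.measurableSet_iterate_image k hBm)))]
      refine (measure_mono ?_).trans (hk k (Finset.mem_range.1 hk'))
      rintro _ ⟨x, hx, rfl⟩
      exact Or.inr ⟨⟨x, hx.1, rfl⟩, hx.2⟩
    · rw [Finset.card_range, nsmul_eq_mul]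
  refine ⟨B', ⟨hB.height_pos, hB'm, fun i hi j hj hij =>
    (hB.disjoint i hi j hj hij).mono (hsub i hi) (hsub j hj)⟩, fun E hE => ?_⟩
  refine (measure_mono (biUnion_symmDiff_subset _ _ _)).trans
    ((measure_biUnion_finset_le _ _).trans ?_)
  have hEcard : (E.card : ℝ≥0∞) ≤ h := by
    have : E.card ≤ (Finset.range h).card :=
      Finset.card_le_card fun i hi => Finset.mem_range.2 (hE i hi)
    rw [Finset.card_range] at this
    exact_mod_cast this
  -- Per level, `h * η` comes from following `S` instead of `T`, and `h * (h * η)` from the trimmed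
  -- part of the base.
  refine (Finset.sum_le_card_nsmul _ _ (h * η + h * (h * η)) fun k hk' => ?_).trans ?_
  · refine (leb_symmDiff_triangle _ (S.toFun^[k] '' B) _).trans (add_le_add (hk k (hE k hk')) ?_)
    refine le_trans (measure_mono ?_) ((S.leb_iterate_image k (hBm.diff hB'm)).le.trans hdiff)
    rintro y (⟨⟨x, hx, rfl⟩, hy⟩ | ⟨⟨x, hx, rfl⟩, hy⟩)
    · exact ⟨x, ⟨hx, fun hx' => hy ⟨x, hx', rfl⟩⟩, rfl⟩
    · exact absurd ⟨x, hx.1, rfl⟩ hy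
  · rw [nsmul_eq_mul]
    gcongr

theorem symmDiff_empty_set {α : Type*} (X : Set α) : X ∆ ∅ = X := symmDiff_bot X

theorem isOpen_approxSet {A : ℕ → Set ℝ≥0} (hA : IsDenseSeq A) (j : ℕ) :
    IsOpen (approxSet A j) := by
  refine isOpen_iff_mem_nhds.2 fun T hT => ?_
  induction T using QuotientGroup.induction_on with
  | H T =>
  obtain ⟨B, h, hB, happ⟩ := hT
  -- Levels of infinite measure cannot occur in an approximating union. The sets `A i` are then
  -- small themselves, and an empty column serves every `S`.
  by_cases hfin : leb B = ∞
  · have hsmall : ∀ i < j, leb (A i) < ENNReal.ofReal (1 / (j : ℝ)) := by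
      intro i hi
      obtain ⟨E, hE, hlt⟩ := happ i hi
      rcases E.eq_empty_or_nonempty with rfl | ⟨k, hk⟩
      · simpa [symmDiff_empty_set] using hlt
      · exfalso
        have h1 : leb (T.toFun^[k] '' B) ≤
            leb (A i ∆ ⋃ i ∈ E, T.toFun^[i] '' B) + leb (A i) := by
          refine (measure_mono fun x hx => ?_).trans (measure_union_le _ _)
          by_cases hxA : x ∈ A i
          · exact Or.inr hxA
          · exact Or.inl (Or.inr ⟨mem_iUnion₂.2 ⟨k, hk, hx⟩, hxA⟩)
        rw [T.leb_iterate_image k hB.measurable_base, hfin] at h1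
        exact absurd h1 (not_le.2 (ENNReal.add_lt_top.2 ⟨hlt.trans_le le_top, hA.finite i⟩))
    refine Filter.Eventually.of_forall fun S => ?_
    induction S using QuotientGroup.induction_on with
    | H S =>
    refine ⟨∅, 1, ⟨le_rfl, MeasurableSet.empty, by simp⟩, fun i hi => ⟨∅, by simp, ?_⟩⟩
    simpa [symmDiff_empty_set] using hsmall i hi
  · choose! E hE hlt using happ
    obtain ⟨δ, hδ0, hδ⟩ : ∃ δ : ℝ≥0, 0 < δ ∧ ∀ i ∈ Finset.range j,
        leb (A i ∆ ⋃ k ∈ E i, T.toFun^[k] '' B) + δ < ENNReal.ofReal (1 / (j : ℝ)) := by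
      have : ∀ᶠ δ : ℝ≥0 in 𝓝[>] 0, ∀ i ∈ Finset.range j,
          leb (A i ∆ ⋃ k ∈ E i, T.toFun^[k] '' B) + δ < ENNReal.ofReal (1 / (j : ℝ)) := by
        refine (Finset.eventually_all _).2 fun i hi => ?_
        have h1 := hlt i (Finset.mem_range.1 hi)
        have hc : Tendsto (fun δ : ℝ≥0 => leb (A i ∆ ⋃ k ∈ E i, T.toFun^[k] '' B) + (δ : ℝ≥0∞))
            (𝓝 0) (𝓝 (leb (A i ∆ ⋃ k ∈ E i, T.toFun^[k] '' B) + ((0 : ℝ≥0) : ℝ≥0∞))) :=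
          (ENNReal.continuous_coe.tendsto 0).const_add _
        rw [ENNReal.coe_zero, add_zero] at hc
        exact (hc.eventually (gt_mem_nhds h1)).filter_mono nhdsWithin_le_nhds
      obtain ⟨δ, h1, h2⟩ := (this.and self_mem_nhdsWithin).exists
      exact ⟨δ, h2, h1⟩
    have hC : (0 : ℝ≥0) < h * (h + h * h) := by
      have : (0 : ℝ≥0) < h := by exact_mod_cast hB.height_pos
      positivity
    -- Chosen so that the error bound of `exists_column_near` equals the slack `δ` common to all `A
    -- i`.
    let η : ℝ≥0 := δ / (h * (h + h * h))
    have hη : 0 < η := div_pos hδ0 hC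
    have hηeq : (h : ℝ≥0∞) * (h * η + h * (h * η)) = δ := by
      have : (h : ℝ≥0) * (h * η + h * (h * η)) = δ := by
        rw [← mul_assoc (h : ℝ≥0) (h : ℝ≥0) η, ← add_mul, ← mul_assoc]
        exact mul_div_cancel₀ _ hC.ne'
      exact_mod_cast this
    have hmem : ∀ᶠ S in 𝓝 (T : MPGroup), ∀ l ∈ Finset.range h,
        weakDist (T.toFun^[l] '' B) T S < ENNReal.ofReal η :=
      (Finset.eventually_all _).2 fun l _ => weakDist_lt_mem_nhds _
        (T.measurableSet_iterate_image l hB.measurable_base)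
        (by rw [T.leb_iterate_image l hB.measurable_base]; exact lt_top_iff_ne_top.2 hfin) hη
    filter_upwards [hmem] with S hS
    induction S using QuotientGroup.induction_on with
    | H S =>
    obtain ⟨B', hB', h2⟩ := exists_column_near (S := S) hB (η := η) fun l hl => by
      have := (hS l (Finset.mem_range.2 hl)).le
      rwa [ENNReal.ofReal_coe_nnreal] at this
    refine ⟨B', h, hB', fun i hi => ⟨E i, hE i hi, ?_⟩⟩
    refine lt_of_le_of_lt ?_ (hδ i (Finset.mem_range.2 hi))
    refine (leb_symmDiff_triangle _ (⋃ k ∈ E i, T.toFun^[k] '' B) _).trans ?_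
    gcongr
    exact (h2 (E i) (hE i hi)).trans hηeq.le

theorem isRankOne_of_mem_approxInter {A : ℕ → Set ℝ≥0} (hA : IsDenseSeq A) :
    approxInter A ⊆ {T | IsRankOne T} := by
  intro T hT
  induction T using QuotientGroup.induction_on with
  | H T =>
  have hT : ∀ j : ℕ, 1 ≤ j → HasApproxColumn A j T := hT
  -- The column numbered `n` resolves `A 0, …, A n` up to `1 / (n + 1)`, hence every fixed `A i`
  -- from `n = i` on.
  choose B h hB happ using fun n : ℕ => hT (n + 1) (Nat.succ_pos n)
  refine ⟨B, h, hB, fun D hD hD' ε hε => ?_⟩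
  obtain ⟨i, hi⟩ := hA.dense D hD hD' (ε / 2) (by linarith)
  obtain ⟨m, hm⟩ := exists_nat_gt (2 / ε)
  refine ⟨max i m, fun n hn => ?_⟩
  obtain ⟨E, hE, hlt⟩ := happ n i (Nat.lt_succ_of_le ((le_max_left _ _).trans hn))
  refine ⟨E, hE, ?_⟩
  have hn' : (1 : ℝ) / ((n + 1 : ℕ) : ℝ) ≤ ε / 2 := by
    have h1 : (m : ℝ) ≤ n := by exact_mod_cast (le_max_right _ _).trans hn
    rw [div_le_iff₀ (by positivity)]
    rw [div_lt_iff₀ hε] at hm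
    push_cast
    nlinarith
  calc _ ≤ _ := leb_symmDiff_triangle _ (A i) _
    _ < ENNReal.ofReal (ε / 2) + ENNReal.ofReal (ε / 2) :=
        ENNReal.add_lt_add hi (hlt.trans_le (ENNReal.ofReal_le_ofReal hn'))
    _ = ENNReal.ofReal ε := by
        rw [← ENNReal.ofReal_add (by linarith) (by linarith)]; congr 1; ring

end Open

/-! ### Density: approximation by cyclic interval exchanges. -/

section Density
open Equiv

/-- The permutation of `ℕ` that acts as `ρ` on the numbers below `Q` and fixes all others. -/
def extendFin {Q : ℕ} (ρ : Perm (Fin Q)) : Perm ℕ := ρ.extendDomain Fin.equivSubtype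

theorem extendFin_val {Q : ℕ} (ρ : Perm (Fin Q)) (w : Fin Q) : extendFin ρ w = ρ w :=
  Perm.extendDomain_apply_image ρ Fin.equivSubtype w

theorem extendFin_of_le {Q : ℕ} (ρ : Perm (Fin Q)) {n : ℕ} (h : Q ≤ n) : extendFin ρ n = n :=
  Perm.extendDomain_apply_not_subtype ρ Fin.equivSubtype (not_lt.2 h)

theorem extendFin_pow_val {Q : ℕ} (ρ : Perm (Fin Q)) (i : ℕ) (w : Fin Q) :
    (extendFin ρ ^ i) w = ((ρ ^ i) w : ℕ) := by
  rw [extendFin, ← Perm.extendDomain_pow]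
  exact extendFin_val (ρ ^ i) w

/-- An interval exchange by a permutation with a single cycle has a column whose levels are all the
intervals that are permuted. -/
theorem exists_column_of_single_cycle {N Q : ℕ} (hN : 0 < N) (hQ : 0 < Q) {ρ : Perm (Fin Q)}
    (hρ : ∀ v w, ρ.SameCycle v w) :
    ∃ (B : Set ℝ≥0) (h : ℕ), IsColumn (cellPerm N hN (extendFin ρ)) B h ∧
      ∀ e : Set ℕ, (∀ n ∈ e, n < Q) → ∃ E : Finset ℕ, (∀ i ∈ E, i < h) ∧
        ⋃ i ∈ E, (cellPerm N hN (extendFin ρ)).toFun^[i] '' B = grid N e := by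
  classical
  let w₀ : Fin Q := ⟨0, hQ⟩
  -- The first `Q` iterates exhaust the single cycle, so by counting they are distinct and the
  -- levels are disjoint.
  have hsurj : Function.Surjective fun i : Fin Q => (ρ ^ (i : ℕ)) w₀ := by
    intro w
    have hcyc : ρ.IsCycleOn ((Finset.univ : Finset (Fin Q)) : Set (Fin Q)) := by
      rw [Finset.coe_univ]
      exact ⟨Set.bijOn_univ.2 ρ.bijective, fun x _ y _ => hρ x y⟩
    obtain ⟨i, hi, h⟩ := hcyc.exists_pow_eq (Finset.mem_univ w₀) (Finset.mem_univ w)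
    exact ⟨⟨i, by simpa using hi⟩, h⟩
  have hinj := Finite.injective_iff_surjective.2 hsurj
  refine ⟨grid N {(w₀ : ℕ)}, Q, ⟨hQ, measurableSet_grid _ _, fun i hi j hj hij => ?_⟩,
    fun e he => ⟨{i ∈ Finset.range Q | (extendFin ρ ^ i) w₀ ∈ e}, by simp; tauto, ?_⟩⟩
  · rw [iterate_cellMap_image, iterate_cellMap_image]
    refine disjoint_grid (disjoint_singleton.2 fun h => hij ?_)
    rw [extendFin_pow_val, extendFin_pow_val] at h
    have := @hinj ⟨i, hi⟩ ⟨j, hj⟩ (Fin.ext h)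
    simpa using this
  · simp only [iterate_cellMap_image]
    ext x
    simp only [Finset.mem_filter, Finset.mem_range, mem_iUnion, mem_grid, mem_singleton_iff,
      exists_prop]
    constructor
    · rintro ⟨i, ⟨-, h1⟩, h2⟩
      rwa [h2]
    · intro h
      obtain ⟨i, hi⟩ := hsurj ⟨_, he _ h⟩
      have hi' : (extendFin ρ ^ (i : ℕ)) w₀ = ⌊x * N⌋₊ := by
        rw [extendFin_pow_val]
        exact congrArg Fin.val hi
      exact ⟨i, ⟨i.2, by rwa [hi']⟩, hi'.symm⟩

theorem leb_inter_preimage_grid {f : ℝ≥0 → ℝ≥0} (hf : Measurable f) {N : ℕ} (e : Finset ℕ)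
    {A : Set ℝ≥0} (hA : MeasurableSet A) :
    leb (A ∩ f ⁻¹' grid N e) = ∑ n ∈ e, leb (A ∩ f ⁻¹' grid N {n}) := by
  rw [grid_eq_biUnion, preimage_iUnion₂, inter_iUnion₂]
  exact measure_biUnion_finset (fun i _ j _ hij =>
    ((disjoint_grid (by simpa using hij)).preimage f).mono inter_subset_right inter_subset_right)
    fun n _ => hA.inter (hf (measurableSet_grid _ _))

theorem leb_real_grid {N : ℕ} (hN : 0 < N) (e : Finset ℕ) : leb.real (grid N e) = e.card / N := by
  rw [measureReal_def, leb_grid hN, ENNReal.toReal_mul, ENNReal.toReal_inv, ENNReal.toReal_natCast,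
    ENNReal.toReal_natCast, div_eq_mul_inv]

theorem leb_real_grid_inter {f : ℝ≥0 → ℝ≥0} (hf : Measurable f) {N : ℕ} (hN : 0 < N)
    (g e : Finset ℕ) : leb.real (grid N g ∩ f ⁻¹' grid N e) =
      ∑ u ∈ g, ∑ v ∈ e, leb.real (grid N {u} ∩ f ⁻¹' grid N {v}) := by
  have hfin : ∀ u v, leb (grid N {u} ∩ f ⁻¹' grid N {v}) ≠ ∞ := fun u v =>
    ((measure_mono inter_subset_left).trans_lt
      (by rw [leb_grid_singleton hN]; simpa using hN)).ne
  simp only [measureReal_def]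
  rw [leb_inter_preimage_grid hf e (measurableSet_grid _ _)]
  have : ∀ v, leb (grid N g ∩ f ⁻¹' grid N {v}) = ∑ u ∈ g, leb (grid N {u} ∩ f ⁻¹' grid N {v}) := by
    intro v
    rw [inter_comm, leb_inter_grid g _ (hf (measurableSet_grid _ _))]
    simp only [inter_comm]
  simp only [this]
  rw [Finset.sum_comm, ENNReal.toReal_sum fun u _ => (ENNReal.sum_lt_top.2 fun v _ => (hfin u v).lt_top).ne]
  exact Finset.sum_congr rfl fun u _ => ENNReal.toReal_sum fun v _ => hfin u v

/-- A measure-preserving map is approximated, on finitely many grid sets, by a permutation. -/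
theorem exists_perm_near {f : ℝ≥0 → ℝ≥0} (hf : MeasurePreserving f leb leb) {N M : ℕ}
    (hN : 0 < N) {ι : Type*} [Fintype ι] (g e : ι → Finset ℕ) (hg : ∀ i, g i ⊆ Finset.range M)
    (he : ∀ i, e i ⊆ Finset.range M) :
    ∃ π : Perm (Fin (M + M)), ∀ i,
      (Finset.card {u : Fin (M + M) | ¬ ((u : ℕ) ∈ g i ↔ (π u : ℕ) ∈ e i)} : ℝ) / N ≤
        ∑ i, leb.real (grid N (g i) ∆ (f ⁻¹' grid N (e i))) := by
  have hN' : (0 : ℝ) < N := by exact_mod_cast hN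
  -- The proportion of cell `u` that `f` sends to cell `v`. Column sums are at most one because `f`
  -- preserves measure; mass may leave or enter the first `M` cells, so the matrix is only
  -- substochastic.
  let m' : ℕ → ℕ → ℝ := fun u v => N * leb.real (grid N {u} ∩ f ⁻¹' grid N {v})
  let m : Fin M → Fin M → ℝ := fun u v => m' u v
  have hfing : ∀ e : Finset ℕ, leb (grid N e) ≠ ∞ := fun e => (leb_grid_lt_top hN e).ne
  have hfin' : ∀ e : Finset ℕ, leb (f ⁻¹' grid N e) ≠ ∞ := fun e => by
    rw [hf.measure_preimage (measurableSet_grid _ _).nullMeasurableSet]; exact hfing e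
  have hreal' : ∀ e : Finset ℕ, leb.real (f ⁻¹' grid N e) = e.card / N := fun e => by
    rw [← leb_real_grid hN, measureReal_def, measureReal_def,
      hf.measure_preimage (measurableSet_grid _ _).nullMeasurableSet]
  have hsum : ∀ g e : Finset ℕ, ∑ u ∈ g, ∑ v ∈ e, m' u v
      = N * leb.real (grid N g ∩ f ⁻¹' grid N e) := fun g e => by
    rw [leb_real_grid_inter hf.measurable hN, Finset.mul_sum]
    simp only [Finset.mul_sum, m']
  have hrow : ∀ u, ∑ v, m u v ≤ 1 := fun u => by
    rw [Fin.sum_univ_eq_sum_range (fun v => m' u v) M]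
    have h1 := hsum {(u : ℕ)} (Finset.range M)
    rw [Finset.sum_singleton] at h1
    rw [h1]
    have h2 : leb.real (grid N ({(u : ℕ)} : Finset ℕ) ∩ f ⁻¹' grid N (Finset.range M : Finset ℕ))
        ≤ leb.real (grid N ({(u : ℕ)} : Finset ℕ)) :=
      measureReal_mono inter_subset_left (hfing _)
    rw [leb_real_grid hN, Finset.card_singleton, le_div_iff₀ hN'] at h2
    rw [mul_comm]
    exact_mod_cast h2
  have hcol : ∀ v, ∑ u, m u v ≤ 1 := fun v => by
    rw [Fin.sum_univ_eq_sum_range (fun u => m' u v) M]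
    have h1 := hsum (Finset.range M) {(v : ℕ)}
    simp only [Finset.sum_singleton] at h1
    rw [h1]
    have h2 : leb.real (grid N (Finset.range M : Finset ℕ) ∩ f ⁻¹' grid N ({(v : ℕ)} : Finset ℕ))
        ≤ leb.real (f ⁻¹' grid N ({(v : ℕ)} : Finset ℕ)) :=
      measureReal_mono inter_subset_right (hfin' _)
    rw [hreal', Finset.card_singleton, le_div_iff₀ hN'] at h2
    rw [mul_comm]
    exact_mod_cast h2
  obtain ⟨π, hπ⟩ := exists_perm_of_substochastic m (fun u v => by positivity) hrow hcol
    Finset.univ g e hg he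
  refine ⟨π, fun i => ?_⟩
  have hterm : ∀ i, ((g i).card : ℝ) + (e i).card - 2 * ∑ u : Fin M, ∑ v : Fin M,
      (if (u : ℕ) ∈ g i ∧ (v : ℕ) ∈ e i then m u v else 0)
      = N * leb.real (grid N (g i) ∆ (f ⁻¹' grid N (e i))) := by
    intro i
    have h1 : ∑ u : Fin M, ∑ v : Fin M, (if (u : ℕ) ∈ g i ∧ (v : ℕ) ∈ e i then m u v else 0)
        = ∑ u ∈ g i, ∑ v ∈ e i, m' u v := by
      rw [Fin.sum_univ_eq_sum_range (fun u => ∑ v : Fin M,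
        if u ∈ g i ∧ (v : ℕ) ∈ e i then m' u v else 0) M, ← Finset.sum_subset (hg i)]
      · refine Finset.sum_congr rfl fun u hu => ?_
        rw [Fin.sum_univ_eq_sum_range (fun v => if u ∈ g i ∧ v ∈ e i then m' u v else 0) M,
          ← Finset.sum_subset (he i)]
        · exact Finset.sum_congr rfl fun v hv => by rw [if_pos ⟨hu, hv⟩]
        · exact fun v _ hv => by rw [if_neg fun h => hv h.2]
      · exact fun u _ hu => Finset.sum_eq_zero fun v _ => by rw [if_neg fun h => hu h.1]
    have hA := measurableSet_grid N (g i : Set ℕ)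
    have hB := hf.measurable (measurableSet_grid N (e i : Set ℕ))
    have h2 := measureReal_inter_add_sdiff (μ := leb) (s := grid N (g i)) hB (hfing _)
    have h3 := measureReal_inter_add_sdiff (μ := leb) (s := f ⁻¹' grid N (e i)) hA (hfin' _)
    have h4 := measureReal_symmDiff_eq (μ := leb) hA hB
      (hfing _) (hfin' _)
    rw [h1, hsum, h4]
    rw [leb_real_grid hN] at h2
    rw [hreal', inter_comm] at h3
    have h5 : ((g i).card : ℝ) = N * ((g i).card / N) := (mul_div_cancel₀ _ hN'.ne').symm
    have h6 : ((e i).card : ℝ) = N * ((e i).card / N) := (mul_div_cancel₀ _ hN'.ne').symm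
    rw [h5, h6, ← h2, ← h3]
    ring
  rw [Finset.sum_congr rfl fun i _ => hterm i, ← Finset.mul_sum] at hπ
  rw [div_le_iff₀ hN', mul_comm]
  refine le_trans ?_ hπ
  -- The permutation controls only the total cost, so each set is charged with the errors of all.
  exact Finset.single_le_sum (f := fun i =>
    (Finset.card {u : Fin (M + M) | ¬ ((u : ℕ) ∈ g i ↔ (π u : ℕ) ∈ e i)} : ℝ))
    (fun i _ => Nat.cast_nonneg _) (Finset.mem_univ i)

/-- A subcell is misplaced only if `ρ` fails to follow `π` there, which happens on at most `2 * (M +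
M)` subcells of length `1 / (N * R)`, or if `π` misplaces the whole cell. -/
theorem leb_grid_symmDiff_preimage_le {N M R : ℕ} (hN : 0 < N) (hR : 0 < R)
    {π : Perm (Fin (M + M))} {ρ : Perm (Fin ((M + M) * R))}
    (hρ : Finset.card {w | (ρ w).divNat ≠ π w.divNat} ≤ 2 * (M + M)) {g e : Finset ℕ}
    (hg : g ⊆ Finset.range M) (he : e ⊆ Finset.range M) :
    leb.real (grid N g ∆ (cellMap (N * R) (extendFin ρ) ⁻¹' grid N e)) ≤
      2 * (M + M) / (N * R) +
      (Finset.card {u : Fin (M + M) | ¬ ((u : ℕ) ∈ g ↔ (π u : ℕ) ∈ e)} : ℝ) / N := by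
  classical
  have hNR : 0 < N * R := Nat.mul_pos hN hR
  have hN' : (0 : ℝ) < N := by exact_mod_cast hN
  have hR' : (0 : ℝ) < R := by exact_mod_cast hR
  let bad : Finset (Fin ((M + M) * R)) := {w | ¬ ((w.divNat : ℕ) ∈ g ↔ ((ρ w).divNat : ℕ) ∈ e)}
  have hsub : grid N g ∆ (cellMap (N * R) (extendFin ρ) ⁻¹' grid N e)
      ⊆ grid (N * R) (bad.map Fin.valEmbedding : Finset ℕ) := by
    rw [grid_mul hR (g : Set ℕ), grid_mul hR (e : Set ℕ), preimage_cellMap hNR]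
    intro x hx
    rw [mem_grid]
    have hx' : ¬ ((⌊x * (N * R : ℕ)⌋₊ / R ∈ g) ↔ (extendFin ρ ⌊x * (N * R : ℕ)⌋₊ / R ∈ e)) := by
      rw [mem_symmDiff] at hx
      simp only [mem_grid, mem_preimage, mem_ofPred_eq, Finset.mem_coe] at hx
      tauto
    generalize ⌊x * (N * R : ℕ)⌋₊ = n at hx'
    rcases lt_or_ge n ((M + M) * R) with hn | hn
    · rw [Finset.mem_coe, Finset.mem_map]
      refine ⟨⟨n, hn⟩, ?_, rfl⟩
      have h1 := extendFin_val ρ ⟨n, hn⟩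
      simp only at h1
      rw [h1] at hx'
      exact Finset.mem_filter.2 ⟨Finset.mem_univ _, hx'⟩
    -- Beyond the permuted range the map is the identity, and both grid sets are empty there.
    · exfalso
      rw [extendFin_of_le ρ hn] at hx'
      have h1 : M ≤ n / R := by
        rw [Nat.le_div_iff_mul_le hR]
        refine le_trans ?_ hn
        gcongr
        omega
      have h2 : ∀ t : Finset ℕ, t ⊆ Finset.range M → n / R ∉ t := fun t ht h => by
        have := Finset.mem_range.1 (ht h)
        omega
      exact hx' (iff_of_false (h2 g hg) (h2 e he))
  have hcard : bad.card ≤ 2 * (M + M) +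
      Finset.card {u : Fin (M + M) | ¬ ((u : ℕ) ∈ g ↔ (π u : ℕ) ∈ e)} * R := by
    have h1 : bad ⊆ ({w | (ρ w).divNat ≠ π w.divNat} : Finset (Fin ((M + M) * R))) ∪
        (({u : Fin (M + M) | ¬ ((u : ℕ) ∈ g ↔ (π u : ℕ) ∈ e)} : Finset (Fin (M + M))) ×ˢ
          (Finset.univ : Finset (Fin R))).map finProdFinEquiv.toEmbedding := by
      intro w hw
      simp only [bad, Finset.mem_filter, Finset.mem_univ, true_and] at hw
      simp only [Finset.mem_union, Finset.mem_filter, Finset.mem_univ, true_and,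
        Finset.mem_map_equiv, Finset.mem_product, and_true]
      by_contra! hcon
      rw [hcon.1] at hw
      exact hw hcon.2
    refine (Finset.card_le_card h1).trans ((Finset.card_union_le _ _).trans ?_)
    rw [Finset.card_map, Finset.card_product, Finset.card_univ, Fintype.card_fin]
    exact Nat.add_le_add_right hρ _
  have h2 := measureReal_mono (μ := leb) hsub (leb_grid_lt_top hNR _).ne
  rw [leb_real_grid hNR, Finset.card_map] at h2
  refine h2.trans ?_
  have hcard' : (bad.card : ℝ) ≤ 2 * (M + M) +
      (Finset.card {u : Fin (M + M) | ¬ ((u : ℕ) ∈ g ↔ (π u : ℕ) ∈ e)} : ℝ) * R := by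
    exact_mod_cast hcard
  rw [Nat.cast_mul]
  calc (bad.card : ℝ) / (N * R) ≤ (2 * (M + M) +
      (Finset.card {u : Fin (M + M) | ¬ ((u : ℕ) ∈ g ↔ (π u : ℕ) ∈ e)} : ℝ) * R) / (N * R) := by
        gcongr
    _ = _ := by field_simp

/-- Weak approximation by a transformation with a column that resolves finitely many sets. -/
theorem exists_near_with_column (T : MPAut) {ι : Type*} [Fintype ι] {A : ι → Set ℝ≥0}
    (hA : ∀ i, MeasurableSet (A i)) (hA' : ∀ i, leb (A i) < ∞) {ε : ℝ} (hε : 0 < ε) :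
    ∃ S : MPAut, (∀ i, leb ((T.toFun ⁻¹' A i) ∆ (S.toFun ⁻¹' A i)) < ENNReal.ofReal ε) ∧
      ∃ (B : Set ℝ≥0) (h : ℕ), IsColumn S B h ∧ ∀ i, ColumnApprox S B h (A i) ε := by
  classical
  let p : ℝ := Fintype.card ι
  have hp : 0 ≤ p := Nat.cast_nonneg _
  -- The errors below total `(2 * p + 3) * η`: one `η` for each of two grid approximations, one for
  -- joining cycles, and `2 * η` for each of the `p` sets in the cost of `π`.
  let η : ℝ := ε / (4 * (p + 1))
  have hη : 0 < η := by positivity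
  have hηε : η ≤ ε := div_le_self hε.le (by linarith)
  let F : ι ⊕ ι → Set ℝ≥0 := Sum.elim A fun i => T.toFun ⁻¹' A i
  have hT := T.measurePreserving
  obtain ⟨N, M, k, hN, hM, hk, hkF⟩ := exists_common_grid_near (A := F) (ε := η)
    (by rintro (i | i); exacts [hA i, T.measurable (hA i)])
    (by
      rintro (i | i)
      exacts [hA' i, by
        change leb (T.toFun ⁻¹' A i) < ∞
        rw [hT.measure_preimage (hA i).nullMeasurableSet]; exact hA' i]) hη
  let e : ι → Finset ℕ := fun i => k (Sum.inl i)
  let g : ι → Finset ℕ := fun i => k (Sum.inr i)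
  have he : ∀ i, leb (A i ∆ grid N (e i)) < ENNReal.ofReal η := fun i => hkF (Sum.inl i)
  have hg : ∀ i, leb ((T.toFun ⁻¹' A i) ∆ grid N (g i)) < ENNReal.ofReal η := fun i => hkF (Sum.inr i)
  obtain ⟨π, hπ⟩ := exists_perm_near hT hN g e (fun i => hk _) fun i => hk _
  have hN' : (0 : ℝ) < N := by exact_mod_cast hN
  obtain ⟨m, hm⟩ := exists_nat_gt (2 * (M + M) / (N * η))
  -- `R` exceeds the number of cells, as the block lemma requires, and is large enough to make the
  -- cost of joining cycles at most `η`.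
  obtain ⟨R, hR1, hR⟩ := Nat.exists_infinite_primes (max m (M + M + 1))
  have hR0 : 0 < R := hR.pos
  have hR' : (0 : ℝ) < R := by exact_mod_cast hR0
  have hRm : (m : ℝ) ≤ R := by exact_mod_cast (le_max_left _ _).trans hR1
  have hRη : 2 * ((M : ℝ) + M) / (N * R) ≤ η := by
    have h1 := (hm.trans_le hRm).le
    rw [div_le_iff₀ (by positivity)] at h1 ⊢
    linarith
  obtain ⟨ρ, hρ, hρπ⟩ := exists_single_cycle_blocks (Nat.add_pos_left hM M) hR
    (lt_of_lt_of_le (Nat.lt_succ_self _) ((le_max_right _ _).trans hR1)) π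
  have hNR := Nat.mul_pos hN hR0
  have hQ : 0 < (M + M) * R := Nat.mul_pos (Nat.add_pos_left hM M) hR0
  let S := cellPerm (N * R) hNR (extendFin ρ)
  have hS := S.measurePreserving
  refine ⟨S, fun i => ?_, ?_⟩
  · have hTi : ∀ i, leb.real (grid N (g i) ∆ (T.toFun ⁻¹' grid N (e i))) ≤ 2 * η := fun i => by
      refine ENNReal.toReal_le_of_le_ofReal (by positivity) ?_
      calc _ ≤ leb (grid N (g i) ∆ (T.toFun ⁻¹' A i)) +
            leb ((T.toFun ⁻¹' A i) ∆ (T.toFun ⁻¹' grid N (e i))) := leb_symmDiff_triangle _ _ _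
        _ ≤ ENNReal.ofReal η + ENNReal.ofReal η := by
            rw [leb_preimage_symmDiff hT (hA i) (measurableSet_grid _ _), symmDiff_comm]
            exact add_le_add (hg i).le (he i).le
        _ = _ := by rw [← ENNReal.ofReal_add hη.le hη.le, two_mul]
    have h1 : leb.real (grid N (g i) ∆ (S.toFun ⁻¹' grid N (e i))) ≤ η + p * (2 * η) := by
      refine (leb_grid_symmDiff_preimage_le hN hR0 hρπ (hk _) (hk _)).trans (add_le_add hRη ?_)
      refine (hπ i).trans ((Finset.sum_le_card_nsmul _ _ (2 * η) fun i _ => hTi i).trans ?_)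
      rw [nsmul_eq_mul, Finset.card_univ]
    have hfin : leb (grid N (g i) ∆ (S.toFun ⁻¹' grid N (e i))) ≠ ∞ := by
      refine ((measure_mono symmDiff_subset_union).trans_lt ((measure_union_le _ _).trans_lt
        (ENNReal.add_lt_top.2 ⟨leb_grid_lt_top hN _, ?_⟩))).ne
      rw [hS.measure_preimage (measurableSet_grid _ _).nullMeasurableSet]
      exact leb_grid_lt_top hN _
    have h2 : leb (grid N (g i) ∆ (S.toFun ⁻¹' grid N (e i))) ≤
        ENNReal.ofReal (η + p * (2 * η)) := by
      rw [← ENNReal.ofReal_toReal hfin]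
      exact ENNReal.ofReal_le_ofReal h1
    calc _ ≤ leb ((T.toFun ⁻¹' A i) ∆ grid N (g i)) +
          (leb (grid N (g i) ∆ (S.toFun ⁻¹' grid N (e i))) +
            leb ((S.toFun ⁻¹' grid N (e i)) ∆ (S.toFun ⁻¹' A i))) :=
          (leb_symmDiff_triangle _ _ _).trans (add_le_add le_rfl (leb_symmDiff_triangle _ _ _))
      _ < ENNReal.ofReal η + (ENNReal.ofReal (η + p * (2 * η)) + ENNReal.ofReal η) := by
          rw [leb_preimage_symmDiff hS (measurableSet_grid _ _) (hA i), symmDiff_comm (grid _ _) (A i)]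
          refine ENNReal.add_lt_add_of_lt_of_le ?_ (hg i) (add_le_add h2 (he i).le)
          exact (ENNReal.add_lt_top.2 ⟨hfin.lt_top.trans_le' le_rfl, (he i).trans_le le_top⟩).ne
      _ ≤ ENNReal.ofReal ε := by
          rw [← ENNReal.ofReal_add (by positivity) hη.le, ← ENNReal.ofReal_add hη.le (by positivity)]
          refine ENNReal.ofReal_le_ofReal ?_
          have : η * (4 * (p + 1)) = ε := div_mul_cancel₀ _ (by positivity)
          nlinarith
  · obtain ⟨B, h, hB, happ⟩ := exists_column_of_single_cycle hNR hQ hρ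
    refine ⟨B, h, hB, fun i => ?_⟩
    obtain ⟨E, hE, hEeq⟩ := happ {n | n / R ∈ e i} fun n hn => by
      have h1 := Finset.mem_range.1 (hk _ hn)
      have h2 := (Nat.div_lt_iff_lt_mul hR0).1 h1
      refine h2.trans_le ?_
      gcongr
      omega
    refine ⟨E, hE, ?_⟩
    have h3 : grid N (e i) = grid (N * R) {n | n / R ∈ e i} := grid_mul hR0 _
    rw [hEeq, ← h3]
    exact (he i).trans_le (ENNReal.ofReal_le_ofReal hηε)

theorem MPAut.bijective (T : MPAut) : Function.Bijective T.toFun := (T : Equiv.Perm ℝ≥0).bijective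

theorem dense_approxSet {A : ℕ → Set ℝ≥0} (hA : IsDenseSeq A) {j : ℕ} (hj : 1 ≤ j) :
    Dense (approxSet A j) := by
  intro T
  rw [mem_closure_iff_nhds]
  intro U hU
  obtain ⟨n, ε, hε, hn⟩ := exists_weakDist_of_mem_nhds hA hU
  induction T using QuotientGroup.induction_on with
  | H T =>
  -- The sets `T '' A i` are included because only preimages are controlled: if `S⁻¹(T A)` is near
  -- `A`, applying `S` shows that `T A` is near `S A`. The last family serves the column, as `j` may
  -- exceed `n`.
  let F : (Fin n ⊕ Fin n) ⊕ Fin j → Set ℝ≥0 :=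
    Sum.elim (Sum.elim (fun i => A i) fun i => T.toFun '' A i) fun i => A i
  have hj' : (0 : ℝ) < 1 / j := by
    have : (0 : ℝ) < j := by exact_mod_cast hj
    positivity
  obtain ⟨S, hS, B, h, hB, happ⟩ := exists_near_with_column T (A := F)
    (by rintro ((i | i) | i); exacts [hA.measurable i, T.measurableSet_image (hA.measurable i),
          hA.measurable i])
    (by
      rintro ((i | i) | i)
      exacts [hA.finite i, (T.leb_image (hA.measurable i)).trans_lt (hA.finite i), hA.finite i])
    (ε := min (ε / 2) (1 / j)) (lt_min (by linarith) hj')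
  refine ⟨S, hn S fun i hi => ?_, ⟨B, h, hB, fun i hi => ?_⟩⟩
  · have h1 : leb ((T.toFun ⁻¹' A i) ∆ (S.toFun ⁻¹' A i)) < ENNReal.ofReal (ε / 2) :=
      (hS (Sum.inl (Sum.inl ⟨i, hi⟩))).trans_le (ENNReal.ofReal_le_ofReal (min_le_left _ _))
    have h2 : leb ((T.toFun ⁻¹' (T.toFun '' A i)) ∆ (S.toFun ⁻¹' (T.toFun '' A i)))
        < ENNReal.ofReal (ε / 2) :=
      (hS (Sum.inl (Sum.inr ⟨i, hi⟩))).trans_le (ENNReal.ofReal_le_ofReal (min_le_left _ _))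
    have h3 : leb ((T⁻¹.toFun ⁻¹' A i) ∆ (S⁻¹.toFun ⁻¹' A i)) < ENNReal.ofReal (ε / 2) := by
      rw [← S.leb_image_symmDiff (T.measurable (T.measurableSet_image (hA.measurable i)))
        (S.measurable (T.measurableSet_image (hA.measurable i))),
        image_preimage_eq _ S.bijective.2, preimage_image_eq _ T.bijective.1, symmDiff_comm,
        T.image_eq, S.image_eq] at h2
      exact h2
    rw [weakDist_mk, autDist_eq]
    refine (ENNReal.add_lt_add h3 h1).trans_eq ?_
    rw [← ENNReal.ofReal_add (by linarith) (by linarith)]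
    congr 1
    ring
  · obtain ⟨E, hE, hlt⟩ := happ (Sum.inr ⟨i, hi⟩)
    exact ⟨E, hE, hlt.trans_le (ENNReal.ofReal_le_ofReal (min_le_right _ _))⟩

end Density

/-! ### From inverse maps almost everywhere to Borel bijections. -/

section Realization
open Filter Topology

/-- The Liouville numbers are null but residual, so by Baire category the nonnegative ones are
uncountable. -/
theorem exists_uncountable_null : ∃ C : Set ℝ≥0, MeasurableSet C ∧ leb C = 0 ∧ ¬ C.Countable := by
  have hGδ : MeasurableSet {x : ℝ | Liouville x} := IsGδ.setOfPred_liouville.measurableSet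
  refine ⟨(↑) ⁻¹' {x : ℝ | Liouville x}, measurableEmbedding_coe_nnreal.measurable hGδ, ?_, fun hC => ?_⟩
  · rw [leb_apply]
    exact measure_mono_null (image_preimage_subset _ _) volume_setOfPred_liouville
  · have h1 : (((↑) '' ((↑) ⁻¹' {x : ℝ | Liouville x} : Set ℝ≥0) : Set ℝ)ᶜ) ∈ residual ℝ := by
      rw [← biUnion_of_singleton (NNReal.toReal '' _), compl_iUnion₂]
      exact (countable_bInter_mem (hC.image _)).2 fun x _ =>
        residual_of_dense_open isOpen_compl_singleton (dense_compl_singleton x)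
    have h2 := dense_of_mem_residual (Filter.inter_mem h1 eventually_residual_liouville)
    obtain ⟨x, hx0, hx1, hx2⟩ := h2.inter_open_nonempty (Ioi 0) isOpen_Ioi ⟨1, mem_Ioi.2 one_pos⟩
    exact hx1 ⟨⟨x, le_of_lt hx0⟩, hx2, rfl⟩

/-- Two measure-preserving maps that are inverse to each other almost everywhere agree almost
everywhere with an element of `MPAut` and its inverse. -/
theorem exists_mpAut_of_ae_inverse {f g : ℝ≥0 → ℝ≥0} (hf : MeasurePreserving f leb leb)
    (hg : MeasurePreserving g leb leb) (hfg : ∀ᵐ x ∂leb, f (g x) = x)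
    (hgf : ∀ᵐ x ∂leb, g (f x) = x) :
    ∃ T : MPAut, T.toFun =ᵐ[leb] f ∧ T⁻¹.toFun =ᵐ[leb] g := by
  classical
  obtain ⟨C, hCm, hC0, hC⟩ := exists_uncountable_null
  -- Removing `C` from domain and image makes both exceptional null sets uncountable.
  have key : ∀ {f g : ℝ≥0 → ℝ≥0}, MeasurePreserving f leb leb → MeasurePreserving g leb leb →
      (∀ᵐ x ∂leb, g (f x) = x) →
      MeasurableSet {x | g (f x) = x ∧ x ∉ C ∧ f x ∉ C} ∧
      (∀ᵐ x ∂leb, x ∈ {x | g (f x) = x ∧ x ∉ C ∧ f x ∉ C}) ∧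
      ¬ Countable ({x | g (f x) = x ∧ x ∉ C ∧ f x ∉ C}ᶜ : Set ℝ≥0) := by
    intro f g hf hg hgf
    refine ⟨?_, ?_, ?_⟩
    · exact (measurableSet_eq_fun (hg.measurable.comp hf.measurable) measurable_id).inter
        (hCm.compl.inter (hf.measurable hCm.compl))
    · have hC' : ∀ᵐ x ∂leb, x ∉ C := measure_eq_zero_iff_ae_notMem.1 hC0
      filter_upwards [hgf, hC', hf.quasiMeasurePreserving.ae hC'] with x h1 h2 h3
      exact ⟨h1, h2, h3⟩
    · intro h
      exact hC ((countable_coe_iff.1 h).mono (fun x hx h' => h'.2.1 hx :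
        C ⊆ {x | g (f x) = x ∧ x ∉ C ∧ f x ∉ C}ᶜ))
  obtain ⟨hXm, hX, hXc⟩ := key hf hg hgf
  obtain ⟨hYm, hY, hYc⟩ := key hg hf hfg
  set X : Set ℝ≥0 := {x | g (f x) = x ∧ x ∉ C ∧ f x ∉ C} with hXdef
  set Y : Set ℝ≥0 := {x | f (g x) = x ∧ x ∉ C ∧ g x ∉ C} with hYdef
  have hXY : ∀ x ∈ X, f x ∈ Y := fun x hx => ⟨congrArg f hx.1, hx.2.2, by rw [hx.1]; exact hx.2.1⟩
  have hYX : ∀ y ∈ Y, g y ∈ X := fun x hx => ⟨congrArg g hx.1, hx.2.2, by rw [hx.1]; exact hx.2.1⟩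
  let e : X ≃ᵐ Y :=
    { toFun := fun x => ⟨f x, hXY x x.2⟩
      invFun := fun y => ⟨g y, hYX y y.2⟩
      left_inv := fun x => Subtype.ext x.2.1
      right_inv := fun y => Subtype.ext y.2.1
      measurable_toFun := (hf.measurable.comp measurable_subtype_coe).subtype_mk
      measurable_invFun := (hg.measurable.comp measurable_subtype_coe).subtype_mk }
  have := hXm.compl.standardBorel
  have := hYm.compl.standardBorel
  -- Uncountable standard Borel spaces are isomorphic; on null sets any Borel isomorphism will do.
  let n : (Xᶜ : Set ℝ≥0) ≃ᵐ (Yᶜ : Set ℝ≥0) := PolishSpace.measurableEquivOfNotCountable hXc hYc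
  let T : ℝ≥0 ≃ᵐ ℝ≥0 := (MeasurableEquiv.sumCompl hXm).symm.trans
    ((MeasurableEquiv.sumCongr e n).trans (MeasurableEquiv.sumCompl hYm))
  have hTf : ∀ x ∈ X, T x = f x := by
    intro x hx
    have : (MeasurableEquiv.sumCompl hXm).symm x = Sum.inl ⟨x, hx⟩ :=
      (MeasurableEquiv.symm_apply_eq _).2 rfl
    change (MeasurableEquiv.sumCompl hYm) ((MeasurableEquiv.sumCongr e n)
      ((MeasurableEquiv.sumCompl hXm).symm x)) = f x
    rw [this]
    rfl
  have hTg : ∀ y ∈ Y, T.symm y = g y := by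
    intro y hy
    rw [MeasurableEquiv.symm_apply_eq, hTf _ (hYX y hy)]
    exact hy.1.symm
  have hTf' : ⇑T =ᵐ[leb] f := hX.mono hTf
  have hTg' : ⇑T.symm =ᵐ[leb] g := hY.mono hTg
  exact ⟨⟨T.toEquiv, ⟨T.measurable, (Measure.map_congr hTf').trans hf.map_eq⟩,
    ⟨T.symm.measurable, (Measure.map_congr hTg').trans hg.map_eq⟩⟩, hTf', hTg'⟩

end Realization

/-! ### Almost everywhere limits of measure-preserving maps. -/

section Limits
open Filter Topology

/-- Fatou's lemma for sets: the lower limit is the increasing union of the tail intersections. -/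
theorem measure_eventually_mem_le {α : Type*} [MeasurableSpace α] {μ : Measure α} {s : ℕ → Set α}
    {c : ℝ≥0∞} (h : ∀ᶠ n in atTop, μ (s n) ≤ c) : μ {x | ∀ᶠ n in atTop, x ∈ s n} ≤ c := by
  have hmono : Monotone fun p : ℕ => ⋂ n ≥ p, s n := fun p q hpq x hx =>
    mem_iInter₂.2 fun n hn => mem_iInter₂.1 hx n (hpq.trans hn)
  have heq : {x | ∀ᶠ n in atTop, x ∈ s n} = ⋃ p : ℕ, ⋂ n ≥ p, s n := by
    ext x
    simp [eventually_atTop]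
  rw [heq, hmono.measure_iUnion]
  refine iSup_le fun p => ?_
  obtain ⟨n, hn, hpn⟩ := (h.and (eventually_ge_atTop p)).exists
  exact (measure_mono fun x hx => mem_iInter₂.1 hx n hpn).trans hn

theorem ae_eventually_notMem_of_le_pow {α : Type*} [MeasurableSpace α] {μ : Measure α}
    {s : ℕ → Set α} (h : ∀ᶠ n in atTop, μ (s n) ≤ 2⁻¹ ^ n) :
    ∀ᵐ x ∂μ, ∀ᶠ n in atTop, x ∉ s n := by
  obtain ⟨N, hN⟩ := eventually_atTop.1 h
  have hsum : ∑' n, μ (s (n + N)) ≠ ∞ := by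
    refine ((ENNReal.tsum_le_tsum fun n => (hN (n + N) (Nat.le_add_left _ _)).trans
      (pow_le_pow_right_of_le_one' (by norm_num) (Nat.le_add_right n N))).trans_lt ?_).ne
    rw [ENNReal.tsum_geometric]
    simp
  filter_upwards [ae_eventually_notMem hsum] with x hx
  obtain ⟨p, hp⟩ := eventually_atTop.1 hx
  refine eventually_atTop.2 ⟨p + N, fun n hn => ?_⟩
  have := hp (n - N) (by omega)
  rwa [Nat.sub_add_cancel (by omega)] at this

/-- Measure-preserving maps whose preimages of grid sets converge fast, and which do not move mass
to infinity, converge almost everywhere. -/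
theorem ae_tendsto_of_grid {f : ℕ → ℝ≥0 → ℝ≥0}
    (hfast : ∀ (N : ℕ) (e : Finset ℕ), 0 < N → ∀ᶠ n in atTop,
      leb ((f n ⁻¹' grid N e) ∆ (f (n + 1) ⁻¹' grid N e)) ≤ 2⁻¹ ^ n)
    (htight : ∀ (m : ℕ) (ε : ℝ≥0∞), 0 < ε → ∃ k : ℕ, ∀ᶠ n in atTop,
      leb (Iio (m : ℝ≥0) ∩ f n ⁻¹' Ici (k : ℝ≥0)) ≤ ε) :
    ∀ᵐ x ∂leb, ∃ l, Tendsto (fun n => f n x) atTop (𝓝 l) := by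
  -- Borel–Cantelli: almost every orbit eventually settles its membership in each of the countably
  -- many bounded grid sets.
  have hconst : ∀ᵐ x ∂leb, ∀ (N : ℕ) (e : Finset ℕ), 0 < N →
      ∀ᶠ n in atTop, ∀ m ≥ n, (f m x ∈ grid N e ↔ f n x ∈ grid N e) := by
    refine ae_all_iff.2 fun N => ae_all_iff.2 fun e => ?_
    by_cases hN : 0 < N
    · filter_upwards [ae_eventually_notMem_of_le_pow (hfast N e hN)] with x hx _
      obtain ⟨p, hp⟩ := eventually_atTop.1 hx
      refine eventually_atTop.2 ⟨p, fun n hn m hm => ?_⟩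
      induction m, hm using Nat.le_induction with
      | base => exact Iff.rfl
      | succ m hm ih =>
        refine Iff.trans ?_ ih
        have := hp m (hn.trans hm)
        simp only [mem_symmDiff, mem_preimage] at this
        tauto
    · exact Eventually.of_forall fun x h => absurd h hN
  have hesc : ∀ᵐ x ∂leb, ¬ ∀ k : ℕ, ∀ᶠ n in atTop, (k : ℝ≥0) ≤ f n x := by
    have h1 : ∀ m : ℕ, leb {x | x < (m : ℝ≥0) ∧ ∀ k : ℕ, ∀ᶠ n in atTop, (k : ℝ≥0) ≤ f n x} = 0 := by
      intro m
      refine le_antisymm (le_of_forall_pos_le_add fun ε hε => ?_) zero_le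
      rw [zero_add]
      obtain ⟨k, hk⟩ := htight m ε hε
      refine (measure_mono ?_).trans (measure_eventually_mem_le hk)
      intro x hx
      filter_upwards [hx.2 k] with n hn
      exact ⟨hx.1, hn⟩
    have h2 : ∀ᵐ x ∂leb, ∀ m : ℕ, ¬ (x < (m : ℝ≥0) ∧ ∀ k : ℕ, ∀ᶠ n in atTop, (k : ℝ≥0) ≤ f n x) :=
      ae_all_iff.2 fun m => measure_eq_zero_iff_ae_notMem.1 (h1 m)
    filter_upwards [h2] with x hx hcon
    obtain ⟨m, hm⟩ := exists_nat_gt x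
    exact hx m ⟨hm, hcon⟩
  filter_upwards [hconst, hesc] with x hx hx'
  push Not at hx'
  obtain ⟨k, hk⟩ := hx'
  -- The sequence is below `k` infinitely often, and membership in `[0, k)` settles, so it stays
  -- there.
  have hbdd : ∀ᶠ n in atTop, f n x < k := by
    have hg : ∀ y : ℝ≥0, y ∈ grid 1 (Finset.range k) ↔ y < k := fun y => by
      rw [Finset.coe_range, grid_Iio one_pos]
      simp
    obtain ⟨p, hp⟩ := eventually_atTop.1 (hx 1 (Finset.range k) one_pos)
    obtain ⟨n, hn, hpn⟩ := (hk.and_eventually (eventually_ge_atTop p)).exists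
    have h1 : f n x < k := hn
    filter_upwards [eventually_ge_atTop n] with m hm
    exact (hg _).1 ((hp n hpn m hm).2 ((hg _).2 h1))
  refine cauchySeq_tendsto_of_complete (Metric.cauchySeq_iff'.2 fun ε hε => ?_)
  obtain ⟨N, hN⟩ := exists_nat_one_div_lt hε
  -- Only finitely many cells of length `1 / (N + 1)` cover `[0, k)`; once membership in all of them
  -- has settled, the sequence stays in one cell.
  have hall : ∀ᶠ n in atTop, ∀ j ∈ Finset.range (k * (N + 1)), ∀ m ≥ n,
      (f m x ∈ grid (N + 1) ({j} : Finset ℕ) ↔ f n x ∈ grid (N + 1) ({j} : Finset ℕ)) :=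
    (Finset.eventually_all _).2 fun j _ => hx (N + 1) {j} (Nat.succ_pos N)
  obtain ⟨n, hn, hn'⟩ := (hall.and hbdd).exists
  refine ⟨n, fun m hm => ?_⟩
  have hj : ⌊f n x * (N + 1 : ℕ)⌋₊ < k * (N + 1) := by
    rw [Nat.floor_lt zero_le]
    push_cast
    gcongr
  have h1 := (hn _ (Finset.mem_range.2 hj) m hm).2 (by simp [mem_grid])
  have h2 : f n x ∈ grid (N + 1) {⌊f n x * (N + 1 : ℕ)⌋₊} := by simp [mem_grid]
  rw [Finset.coe_singleton, grid_singleton (Nat.succ_pos N)] at h1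
  rw [grid_singleton (Nat.succ_pos N)] at h2
  refine lt_of_lt_of_le ?_ hN.le
  generalize ⌊f n x * (N + 1 : ℕ)⌋₊ = j at h1 h2
  have h3 : (((j + 1 : ℕ) : ℝ≥0) / ((N + 1 : ℕ) : ℝ≥0) : ℝ) =
      ((j : ℝ≥0) / ((N + 1 : ℕ) : ℝ≥0) : ℝ) + 1 / ((N : ℝ) + 1) := by
    push_cast
    rw [add_div]
  have h4 : ((j : ℝ≥0) / ((N + 1 : ℕ) : ℝ≥0) : ℝ) ≤ f m x := by exact_mod_cast h1.1
  have h5 : (f m x : ℝ) < (((j + 1 : ℕ) : ℝ≥0) / ((N + 1 : ℕ) : ℝ≥0) : ℝ) := by exact_mod_cast h1.2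
  have h6 : ((j : ℝ≥0) / ((N + 1 : ℕ) : ℝ≥0) : ℝ) ≤ f n x := by exact_mod_cast h2.1
  have h7 : (f n x : ℝ) < (((j + 1 : ℕ) : ℝ≥0) / ((N + 1 : ℕ) : ℝ≥0) : ℝ) := by exact_mod_cast h2.2
  rw [NNReal.dist_eq, abs_lt]
  constructor <;> linarith

/-- An almost everywhere limit of measure-preserving maps does not increase the measure of
preimages. -/
theorem leb_preimage_le_of_ae_tendsto {f : ℕ → ℝ≥0 → ℝ≥0}
    (hf : ∀ n, MeasurePreserving (f n) leb leb) {F : ℝ≥0 → ℝ≥0}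
    (hlim : ∀ᵐ x ∂leb, Tendsto (fun n => f n x) atTop (𝓝 (F x))) (A : Set ℝ≥0) :
    leb (F ⁻¹' A) ≤ leb A := by
  -- By outer regularity it suffices to treat open sets, which contain the approximants once they
  -- contain the limit.
  rw [A.measure_eq_iInf_isOpen leb]
  refine le_iInf fun U => le_iInf fun hAU => le_iInf fun hU => ?_
  refine le_trans ?_ (measure_eventually_mem_le (μ := leb) (s := fun n => f n ⁻¹' U)
    (Eventually.of_forall fun n =>
      ((hf n).measure_preimage hU.measurableSet.nullMeasurableSet).le))
  refine measure_mono_ae ?_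
  filter_upwards [hlim] with x hx hxA
  exact hx.eventually (hU.mem_nhds (hAU hxA))

/-- Where `f n` and `F` disagree about `G`, membership must change at some step `m ≥ n`; the bounds
for these steps form a geometric series. -/
theorem leb_symmDiff_limit_le {f : ℕ → ℝ≥0 → ℝ≥0} {F : ℝ≥0 → ℝ≥0} {G : Set ℝ≥0} {n : ℕ}
    (hlim : ∀ᵐ x ∂leb, ∀ᶠ m in atTop, (f m x ∈ G ↔ F x ∈ G))
    (hfast : ∀ m ≥ n, leb ((f m ⁻¹' G) ∆ (f (m + 1) ⁻¹' G)) ≤ 2⁻¹ ^ m) :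
    leb ((f n ⁻¹' G) ∆ (F ⁻¹' G)) ≤ 2⁻¹ ^ n * 2 := by
  have hsub : ((f n ⁻¹' G) ∆ (F ⁻¹' G) : Set ℝ≥0) ≤ᵐ[leb]
      (⋃ m, (f (n + m) ⁻¹' G) ∆ (f (n + m + 1) ⁻¹' G) : Set ℝ≥0) := by
    filter_upwards [hlim] with x hx hx'
    by_contra hcon
    have hcon : x ∉ ⋃ m, (f (n + m) ⁻¹' G) ∆ (f (n + m + 1) ⁻¹' G) := hcon
    have hx' : x ∈ (f n ⁻¹' G) ∆ (F ⁻¹' G) := hx'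
    rw [mem_iUnion, not_exists] at hcon
    have hconst : ∀ m, (f (n + m) x ∈ G ↔ f n x ∈ G) := by
      intro m
      induction m with
      | zero => exact Iff.rfl
      | succ m ih =>
        have := hcon m
        simp only [mem_symmDiff, mem_preimage] at this
        rw [← ih, ← add_assoc]
        tauto
    obtain ⟨m, hm, hnm⟩ := (hx.and (eventually_ge_atTop n)).exists
    obtain ⟨d, rfl⟩ := Nat.exists_eq_add_of_le hnm
    have := hconst d
    simp only [mem_symmDiff, mem_preimage] at hx'
    tauto
  refine (measure_mono_ae hsub).trans ((measure_iUnion_le _).trans ?_)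
  calc _ ≤ ∑' m, (2⁻¹ : ℝ≥0∞) ^ n * 2⁻¹ ^ m :=
        ENNReal.tsum_le_tsum fun m => (hfast (n + m) (Nat.le_add_right _ _)).trans_eq (pow_add _ _ _)
    _ = _ := by
        rw [ENNReal.tsum_mul_left, ENNReal.tsum_geometric]
        simp

/-- A limit that is not an endpoint lies in the interior of its half-open cell. -/
theorem eventually_mem_grid_iff {N : ℕ} (hN : 0 < N) (e : Set ℕ) {u : ℕ → ℝ≥0} {l : ℝ≥0}
    (hu : Tendsto u atTop (𝓝 l)) (hl : ∀ j : ℕ, l ≠ (j : ℝ≥0) / N) :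
    ∀ᶠ n in atTop, (u n ∈ grid N e ↔ l ∈ grid N e) := by
  have h1 : l ∈ grid N {⌊l * N⌋₊} := by simp [mem_grid]
  rw [grid_singleton hN] at h1
  have h2 := Ioo_mem_nhds (lt_of_le_of_ne h1.1 (hl _).symm) h1.2
  filter_upwards [hu.eventually h2] with n hn
  have h3 : u n ∈ grid N {⌊l * N⌋₊} := by
    rw [grid_singleton hN]
    exact ⟨hn.1.le, hn.2⟩
  rw [mem_grid, mem_grid, show ⌊u n * N⌋₊ = ⌊l * N⌋₊ from h3]

/-- The limit of measure-preserving maps whose preimages of grid sets converge fast and which do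
not move mass to infinity. -/
theorem exists_limit_of_grid {f : ℕ → ℝ≥0 → ℝ≥0} (hf : ∀ n, MeasurePreserving (f n) leb leb)
    (hfast : ∀ (N : ℕ) (e : Finset ℕ), 0 < N → ∀ᶠ n in atTop,
      leb ((f n ⁻¹' grid N e) ∆ (f (n + 1) ⁻¹' grid N e)) ≤ 2⁻¹ ^ n)
    (htight : ∀ (m : ℕ) (ε : ℝ≥0∞), 0 < ε → ∃ k : ℕ, ∀ᶠ n in atTop,
      leb (Iio (m : ℝ≥0) ∩ f n ⁻¹' Ici (k : ℝ≥0)) ≤ ε) :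
    ∃ F : ℝ≥0 → ℝ≥0, Measurable F ∧ (∀ A, leb (F ⁻¹' A) ≤ leb A) ∧
      ∀ A, MeasurableSet A → leb A < ∞ →
        Tendsto (fun n => leb ((f n ⁻¹' A) ∆ (F ⁻¹' A))) atTop (𝓝 0) := by
  obtain ⟨F, hF, hlim⟩ := measurable_limit_of_tendsto_metrizable_ae
    (fun n => (hf n).measurable.aemeasurable) (ae_tendsto_of_grid hfast htight)
  have hle := leb_preimage_le_of_ae_tendsto hf hlim
  refine ⟨F, hF, hle, fun A hA hA' => ?_⟩
  have hgrid : ∀ (N : ℕ) (e : Finset ℕ), 0 < N →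
      Tendsto (fun n => leb ((f n ⁻¹' grid N e) ∆ (F ⁻¹' grid N e))) atTop (𝓝 0) := by
    intro N e hN
    -- Endpoints are countable, and `F` pulls null sets back to null sets.
    have hnull : leb (F ⁻¹' range fun j : ℕ => (j : ℝ≥0) / N) = 0 :=
      le_antisymm ((hle _).trans_eq ((countable_range _).measure_zero leb)) zero_le
    have hmem : ∀ᵐ x ∂leb, ∀ᶠ m in atTop, (f m x ∈ grid N e ↔ F x ∈ grid N e) := by
      filter_upwards [hlim, measure_eq_zero_iff_ae_notMem.1 hnull] with x hx hx'
      exact eventually_mem_grid_iff hN e hx fun j hj => hx' ⟨j, hj.symm⟩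
    have hpow : Tendsto (fun n : ℕ => (2⁻¹ : ℝ≥0∞) ^ n * 2) atTop (𝓝 0) := by
      have := ENNReal.Tendsto.mul_const (b := 2)
        (ENNReal.tendsto_pow_atTop_nhds_zero_of_lt_one (r := 2⁻¹) (by norm_num))
        (Or.inr (by norm_num))
      rwa [zero_mul] at this
    obtain ⟨p, hp⟩ := eventually_atTop.1 (hfast N e hN)
    refine tendsto_of_tendsto_of_tendsto_of_le_of_le' tendsto_const_nhds hpow
      (Eventually.of_forall fun _ => zero_le) ?_
    filter_upwards [eventually_ge_atTop p] with n hn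
    exact leb_symmDiff_limit_le hmem fun m hm => hp m (hn.trans hm)
  refine ENNReal.tendsto_nhds_zero.2 fun ε hε => ?_
  have hε3 : 0 < ε / 3 := ENNReal.div_pos hε.ne' (by norm_num)
  obtain ⟨δ, hδ0, hδ⟩ := ENNReal.lt_iff_exists_nnreal_btwn.1 hε3
  obtain ⟨N, e, hN, he⟩ := exists_grid_near hA hA' (ε := δ) (by exact_mod_cast hδ0)
  rw [ENNReal.ofReal_coe_nnreal] at he
  have he' := (he.trans hδ).le
  filter_upwards [ENNReal.tendsto_nhds_zero.1 (hgrid N e hN) _ hε3] with n hn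
  have hGm := measurableSet_grid N (e : Set ℕ)
  calc _ ≤ leb ((f n ⁻¹' A) ∆ (f n ⁻¹' grid N e)) + (leb ((f n ⁻¹' grid N e) ∆ (F ⁻¹' grid N e)) +
          leb ((F ⁻¹' grid N e) ∆ (F ⁻¹' A))) :=
        (leb_symmDiff_triangle _ _ _).trans (add_le_add le_rfl (leb_symmDiff_triangle _ _ _))
    _ ≤ ε / 3 + (ε / 3 + ε / 3) := by
        rw [leb_preimage_symmDiff (hf n) hA hGm, ← preimage_symmDiff, symmDiff_comm (grid N _) A]
        exact add_le_add he' (add_le_add hn ((hle _).trans he'))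
    _ = ε := by rw [← add_assoc]; exact ENNReal.add_thirds ε

end Limits

/-! ### Completeness and the Baire property. -/

section Baire
open Filter Topology

theorem autDist_inv (A : Set ℝ≥0) (T S : MPAut) : autDist A T⁻¹ S⁻¹ = autDist A T S := by
  rw [autDist, autDist, inv_inv, inv_inv, add_comm]

/-- A Cauchy sequence of transformations does not move mass to infinity. -/
theorem tight_of_cauchy {T : ℕ → MPAut}
    (hC : ∀ A, MeasurableSet A → leb A < ∞ → ∀ ε : ℝ≥0∞, 0 < ε →
      ∃ N, ∀ n ≥ N, ∀ m ≥ N, autDist A (T n) (T m) ≤ ε) (m : ℕ) {ε : ℝ≥0∞} (hε : 0 < ε) :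
    ∃ k : ℕ, ∀ᶠ n in atTop, leb (Iio (m : ℝ≥0) ∩ (T n).toFun ⁻¹' Ici (k : ℝ≥0)) ≤ ε := by
  have hfin : leb (Iio (m : ℝ≥0)) < ∞ := by rw [leb_Iio]; exact ENNReal.coe_lt_top
  have hε2 : 0 < ε / 2 := ENNReal.half_pos hε.ne'
  -- For `n ≥ N` the image of `[0, m)` under `T n` is near that under the single map `T N`, which
  -- has little mass beyond a suitable `k`.
  obtain ⟨N, hN⟩ := hC (Iio (m : ℝ≥0)) measurableSet_Iio hfin (ε / 2) hε2
  have hYm : MeasurableSet ((T N).toFun '' Iio (m : ℝ≥0)) :=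
    (T N).measurableSet_image measurableSet_Iio
  have hlim := tendsto_measure_iInter_atTop (μ := leb)
    (s := fun k : ℕ => (T N).toFun '' Iio (m : ℝ≥0) ∩ Ici (k : ℝ≥0))
    (fun k => (hYm.inter measurableSet_Ici).nullMeasurableSet)
    (fun k l hkl x hx => ⟨hx.1, (Nat.cast_le.2 hkl).trans (mem_Ici.1 hx.2)⟩)
    ⟨0, ((measure_mono inter_subset_left).trans_lt
      (((T N).leb_image measurableSet_Iio).trans_lt hfin)).ne⟩
  have hempty : ⋂ k : ℕ, (T N).toFun '' Iio (m : ℝ≥0) ∩ Ici (k : ℝ≥0) = ∅ := by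
    refine eq_empty_of_forall_notMem fun x hx => ?_
    obtain ⟨k, hk⟩ := exists_nat_gt x
    exact absurd (mem_iInter.1 hx k).2 (not_le.2 hk)
  rw [hempty, measure_empty] at hlim
  obtain ⟨k, hk⟩ := (ENNReal.tendsto_nhds_zero.1 hlim _ hε2).exists
  refine ⟨k, ?_⟩
  filter_upwards [eventually_ge_atTop N] with n hn
  have hXm : MeasurableSet (Iio (m : ℝ≥0) ∩ (T n).toFun ⁻¹' Ici (k : ℝ≥0)) :=
    measurableSet_Iio.inter ((T n).measurable measurableSet_Ici)
  rw [← (T n).leb_image hXm, image_inter_preimage]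
  calc _ ≤ leb ((((T n).toFun '' Iio (m : ℝ≥0)) ∆ ((T N).toFun '' Iio (m : ℝ≥0))) ∪
          ((T N).toFun '' Iio (m : ℝ≥0) ∩ Ici (k : ℝ≥0))) := by
        refine measure_mono fun x hx => ?_
        by_cases h : x ∈ (T N).toFun '' Iio (m : ℝ≥0)
        · exact Or.inr ⟨h, hx.2⟩
        · exact Or.inl (Or.inl ⟨hx.1, h⟩)
    _ ≤ ε / 2 + ε / 2 := (measure_union_le _ _).trans
        (add_le_add (le_self_add.trans (hN n hn N le_rfl)) hk)
    _ = ε := ENNReal.add_halves ε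

theorem eq_of_forall_mem_grid_iff {x y : ℝ≥0}
    (h : ∀ (N j : ℕ), 0 < N → (x ∈ grid N {j} ↔ y ∈ grid N {j})) : x = y := by
  have hfloor : ∀ N : ℕ, 0 < N → ⌊x * N⌋₊ = ⌊y * N⌋₊ := fun N hN =>
    ((h N ⌊x * N⌋₊ hN).1 (by simp [mem_grid])).symm
  have hlt : ∀ {a b : ℝ≥0}, (∀ N : ℕ, 0 < N → ⌊a * N⌋₊ = ⌊b * N⌋₊) → ¬ a < b := by
    intro a b hab hlt
    obtain ⟨N, k, hN, h1, h2⟩ := exists_nat_div_near hlt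
    have hN' : (0 : ℝ≥0) < N := by exact_mod_cast hN
    rw [lt_div_iff₀ hN', ← Nat.floor_lt zero_le] at h1
    rw [div_lt_iff₀ hN'] at h2
    have h3 := Nat.le_floor h2.le
    have := hab N hN
    omega
  exact le_antisymm (not_lt.1 (hlt fun N hN => (hfloor N hN).symm)) (not_lt.1 (hlt hfloor))

/-- The limits of `T n` and of the inverses of `T n` are inverse to each other. -/
theorem ae_comp_eq_of_limits {T : ℕ → MPAut} {F G : ℝ≥0 → ℝ≥0} (hF : Measurable F)
    (hFle : ∀ A, leb (F ⁻¹' A) ≤ leb A)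
    (hFlim : ∀ A, MeasurableSet A → leb A < ∞ →
      Tendsto (fun n => leb (((T n).toFun ⁻¹' A) ∆ (F ⁻¹' A))) atTop (𝓝 0))
    (hGlim : ∀ A, MeasurableSet A → leb A < ∞ →
      Tendsto (fun n => leb (((T n)⁻¹.toFun ⁻¹' A) ∆ (G ⁻¹' A))) atTop (𝓝 0)) :
    ∀ᵐ x ∂leb, F (G x) = x := by
  -- `A` is the preimage under `(T n)⁻¹` of its preimage under `T n`. Replacing the inner preimage
  -- by that of `F`, then the outer one by that of `G`, costs errors that tend to zero.
  have hset : ∀ A, MeasurableSet A → leb A < ∞ → leb (A ∆ (G ⁻¹' (F ⁻¹' A))) = 0 := by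
    intro A hA hA'
    have hlim := (hFlim A hA hA').add (hGlim (F ⁻¹' A) (hF hA) ((hFle A).trans_lt hA'))
    rw [add_zero] at hlim
    refine le_antisymm (ge_of_tendsto' hlim fun n => ?_) zero_le
    refine (leb_symmDiff_triangle _ ((T n)⁻¹.toFun ⁻¹' (F ⁻¹' A)) _).trans (add_le_add ?_ le_rfl)
    rw [← leb_preimage_symmDiff (T n)⁻¹.measurePreserving ((T n).measurable hA) (hF hA),
      ← preimage_comp (g := (T n).toFun), MPAut.toFun_comp_inv, preimage_id]
  have hall : ∀ᵐ x ∂leb, ∀ (N j : ℕ), 0 < N → (F (G x) ∈ grid N {j} ↔ x ∈ grid N {j}) := by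
    refine ae_all_iff.2 fun N => ae_all_iff.2 fun j => ?_
    by_cases hN : 0 < N
    · have h0 := hset (grid N {j}) (measurableSet_grid _ _)
        (by rw [leb_grid_singleton hN]; simpa using hN)
      filter_upwards [measure_eq_zero_iff_ae_notMem.1 h0] with x hx _
      simp only [mem_symmDiff, mem_preimage] at hx
      tauto
    · exact Eventually.of_forall fun x h => absurd h hN
  filter_upwards [hall] with x hx
  exact eq_of_forall_mem_grid_iff hx

/-- A fast Cauchy sequence of transformations converges. -/
theorem exists_limit_of_cauchy {T : ℕ → MPAut}
    (hC : ∀ A, MeasurableSet A → leb A < ∞ → ∀ ε : ℝ≥0∞, 0 < ε →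
      ∃ N, ∀ n ≥ N, ∀ m ≥ N, autDist A (T n) (T m) ≤ ε)
    (hfast : ∀ (N : ℕ) (e : Finset ℕ), 0 < N → ∀ᶠ n in atTop,
      autDist (grid N e) (T n) (T (n + 1)) ≤ 2⁻¹ ^ n) :
    ∃ S : MPAut, ∀ A, MeasurableSet A → leb A < ∞ →
      Tendsto (fun n => autDist A (T n) S) atTop (𝓝 0) := by
  have key : ∀ T : ℕ → MPAut, (∀ A, MeasurableSet A → leb A < ∞ → ∀ ε : ℝ≥0∞, 0 < ε →
      ∃ N, ∀ n ≥ N, ∀ m ≥ N, autDist A (T n) (T m) ≤ ε) →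
      (∀ (N : ℕ) (e : Finset ℕ), 0 < N → ∀ᶠ n in atTop,
        autDist (grid N e) (T n) (T (n + 1)) ≤ 2⁻¹ ^ n) →
      ∃ F : ℝ≥0 → ℝ≥0, Measurable F ∧ (∀ A, leb (F ⁻¹' A) ≤ leb A) ∧
        ∀ A, MeasurableSet A → leb A < ∞ →
          Tendsto (fun n => leb (((T n).toFun ⁻¹' A) ∆ (F ⁻¹' A))) atTop (𝓝 0) := by
    intro T hC hfast
    refine exists_limit_of_grid (fun n => (T n).measurePreserving) (fun N e hN => ?_)
      fun m ε hε => tight_of_cauchy hC m hε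
    filter_upwards [hfast N e hN] with n hn
    rw [autDist_eq] at hn
    exact le_add_self.trans hn
  obtain ⟨F, hF, hFle, hFlim⟩ := key T hC hfast
  obtain ⟨G, hG, hGle, hGlim⟩ := key (fun n => (T n)⁻¹)
    (by simpa only [autDist_inv] using hC) (by simpa only [autDist_inv] using hfast)
  have hFG : ∀ᵐ x ∂leb, F (G x) = x := ae_comp_eq_of_limits hF hFle hFlim hGlim
  have hGF : ∀ᵐ x ∂leb, G (F x) = x :=
    ae_comp_eq_of_limits (T := fun n => (T n)⁻¹) hG hGle hGlim (by simpa only [inv_inv] using hFlim)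
  -- Neither limit increases the measure of preimages, and the composition preserves it, so equality
  -- holds.
  have hmp : ∀ {F G : ℝ≥0 → ℝ≥0}, Measurable F → (∀ A, leb (F ⁻¹' A) ≤ leb A) →
      (∀ A, leb (G ⁻¹' A) ≤ leb A) → (∀ᵐ x ∂leb, F (G x) = x) → MeasurePreserving F leb leb := by
    intro F G hF hFle hGle hFG
    refine ⟨hF, Measure.ext fun A hA => ?_⟩
    rw [Measure.map_apply hF hA]
    refine le_antisymm (hFle A) ?_
    have h1 : leb A = leb (G ⁻¹' (F ⁻¹' A)) := by
      refine measure_congr ?_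
      filter_upwards [hFG] with x hx
      exact congrArg (· ∈ A) hx.symm
    exact h1.trans_le (hGle _)
  obtain ⟨S, hSF, hSG⟩ := exists_mpAut_of_ae_inverse (hmp hF hFle hGle hFG) (hmp hG hGle hFle hGF)
    hFG hGF
  refine ⟨S, fun A hA hA' => ?_⟩
  have hpre : ∀ {f g : ℝ≥0 → ℝ≥0}, f =ᵐ[leb] g → ∀ B : Set ℝ≥0,
      leb (B ∆ (f ⁻¹' A)) = leb (B ∆ (g ⁻¹' A)) := by
    intro f g hfg B
    refine measure_congr ((ae_eq_refl B).symmDiff ?_)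
    filter_upwards [hfg] with x hx
    exact congrArg (· ∈ A) hx
  simp only [autDist_eq, hpre hSF, hpre hSG]
  simpa using (hGlim A hA hA').add (hFlim A hA hA')

/-- All bounded grid sets must occur in `D`: the convergence argument needs the bounds `2⁻¹ ^ n` for
these sets themselves, which nearby sets would not give. -/
theorem completeSpace_weakEMetric {D : ℕ → Set ℝ≥0} (hD : IsDenseSeq D)
    (hgrid : ∀ (N : ℕ) (e : Finset ℕ), 0 < N → ∃ i, D i = grid N e) :
    @CompleteSpace MPGroup (weakEMetric D).toUniformSpace := by
  refine @EMetric.complete_of_convergent_controlled_sequences _ (weakEMetric D) (fun n => 2⁻¹ ^ n)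
    (fun n => ENNReal.pow_pos (by norm_num) n) fun u hu => ?_
  choose T hT using fun n => QuotientGroup.mk_surjective (s := aeId) (u n)
  -- For `i ≤ N` the cap `2⁻¹ ^ i` is at least `2⁻¹ ^ N`, so the distance controls `D i` directly.
  have hD' : ∀ i N, i ≤ N → ∀ n ≥ N, ∀ m ≥ N, autDist (D i) (T n) (T m) ≤ 2⁻¹ ^ N := by
    intro i N hi n hn m hm
    rw [← weakDist_mk, hT, hT]
    exact (weakDist_lt_of_edist_lt (hu N n m hn hm)
      (pow_le_pow_right_of_le_one' (by norm_num) hi)).le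
  obtain ⟨S, hS⟩ := exists_limit_of_cauchy (T := T) (by
      intro A hA hA' ε hε
      obtain ⟨δ, hδ0, hδ⟩ := ENNReal.lt_iff_exists_nnreal_btwn.1
        (ENNReal.div_pos (ENNReal.half_pos hε.ne').ne' (by norm_num : (4 : ℝ≥0∞) ≠ ∞))
      obtain ⟨i, hi⟩ := hD.dense A hA hA' δ (by exact_mod_cast hδ0)
      rw [ENNReal.ofReal_coe_nnreal] at hi
      obtain ⟨p, hp⟩ := ENNReal.exists_inv_two_pow_lt (ENNReal.half_pos hε.ne').ne'
      refine ⟨max i p, fun n hn m hm => ?_⟩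
      rw [← weakDist_mk]
      refine (weakDist_le hA (hD.measurable i) _ _).trans ?_
      calc _ ≤ ε / 2 + 4 * (ε / 2 / 4) := by
            refine add_le_add ?_ ?_
            · exact (hD' i _ (le_max_left _ _) n hn m hm).trans
                ((pow_le_pow_right_of_le_one' (by norm_num) (le_max_right i p)).trans hp.le)
            · gcongr
              exact (hi.trans hδ).le
        _ = ε := by
            rw [ENNReal.mul_div_cancel (by norm_num) (by norm_num), ENNReal.add_halves])
    (by
      intro N e hN
      obtain ⟨i, hi⟩ := hgrid N e hN
      filter_upwards [eventually_ge_atTop i] with n hn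
      rw [← hi]
      exact hD' i n hn n le_rfl (n + 1) (Nat.le_succ n))
  refine ⟨(S : MPGroup), (@EMetric.tendsto_atTop _ _ (weakEMetric D) _ _ _ _).2 fun ε hε => ?_⟩
  obtain ⟨p, hp⟩ := ENNReal.exists_inv_two_pow_lt hε.ne'
  have hev : ∀ᶠ n in atTop, ∀ i ∈ Finset.range p, autDist (D i) (T n) S ≤ 2⁻¹ ^ p :=
    (Finset.eventually_all _).2 fun i _ => ENNReal.tendsto_nhds_zero.1
      (hS (D i) (hD.measurable i) (hD.finite i)) _ (ENNReal.pow_pos (by norm_num) p)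
  obtain ⟨N, hN⟩ := eventually_atTop.1 hev
  refine ⟨N, fun n hn => ?_⟩
  refine lt_of_le_of_lt (iSup_le fun i => ?_) hp
  rcases lt_or_ge i p with hi | hi
  · refine (min_le_right _ _).trans ?_
    rw [← hT, weakDist_mk]
    exact hN n hn i (Finset.mem_range.2 hi)
  · exact (min_le_left _ _).trans (pow_le_pow_right_of_le_one' (by norm_num) hi)

/-- The weak topology has the Baire property. -/
theorem baireSpace_weakTopology : BaireSpace MPGroup := by
  obtain ⟨D, hD, hgrid⟩ := exists_gridSeq
  rw [weakTopology_eq hD]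
  have := completeSpace_weakEMetric hD hgrid
  let _ := weakEMetric D
  infer_instance

theorem approxInter_eq_iInter (A : ℕ → Set ℝ≥0) : approxInter A = ⋂ n : ℕ, approxSet A (n + 1) := by
  ext T
  rw [mem_iInter]
  exact ⟨fun h n => h (n + 1) (Nat.succ_pos n), fun h j hj => by
    simpa only [Nat.sub_add_cancel hj] using h (j - 1)⟩

theorem isGδ_and_dense_approxInter {A : ℕ → Set ℝ≥0} (hA : IsDenseSeq A) :
    IsGδ (approxInter A) ∧ Dense (approxInter A) := by
  have := baireSpace_weakTopology
  rw [approxInter_eq_iInter]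
  exact ⟨IsGδ.iInter_of_isOpen fun n => isOpen_approxSet hA (n + 1),
    dense_iInter_of_isOpen_nat (fun n => isOpen_approxSet hA (n + 1))
      fun n => dense_approxSet hA (Nat.succ_pos n)⟩

end Baire

theorem mainTheorem8 :
    (∃ R : Set MPGroup, R ⊆ {T | IsRankOne T} ∧ IsGδ R ∧ Dense R) ∧
    ∀ A : ℕ → Set ℝ≥0, IsDenseSeq A →
      (∀ j : ℕ, 1 ≤ j → IsOpen (approxSet A j) ∧ Dense (approxSet A j)) ∧
      approxInter A ⊆ {T | IsRankOne T} ∧ IsGδ (approxInter A) ∧ Dense (approxInter A) := by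
  refine ⟨?_, fun A hA => ⟨fun j hj => ⟨isOpen_approxSet hA j, dense_approxSet hA hj⟩,
    isRankOne_of_mem_approxInter hA, isGδ_and_dense_approxInter hA⟩⟩
  obtain ⟨D, hD, -⟩ := exists_gridSeq
  exact ⟨approxInter D, isRankOne_of_mem_approxInter hD, isGδ_and_dense_approxInter hD⟩
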